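/- Let $u_0:\mathbb R\to\mathbb R$ be absolutely continuous with $u_0'=w_0$ a.e., $w_0\in L^2(\mathbb R)$. A weak solution of the Hunter--Saxton equation $$\partial_t u+\partial_x\Big[\tfrac12u^2\Big]=\tfrac12\int_{-\infty}^x w^2(y,t)\,dy,\qquad w=\partial_x u,$$ with initial datum $u_0$ is a continuous function $u$ on $\mathbb R\times[0,\infty)$ such that $u(\cdot,t)$ is (locally) absolutely continuous for every $t\ge0$, $w\in L^\infty([0,\infty);L^2(\mathbb R))$, $t\mapsto u(\cdot,t)\in L^2_{loc}(\mathbb R)$ is (locally) absolutely continuous, the equation holds in the sense of distributions, and $u(\cdot,0)=u_0$. A characteristic of $u$ on $[0,T]$ emanating from $\zeta$ is a Lipschitz function $x:[0,T]\to\mathbb R$ with $\dot x(s)=u(x(s),s)$ for a.e. $s\in[0,T]$ and $x(0)=\zeta$; the leftmost characteristic $x_l[\eta]$ is the pointwise infimum of all characteristics emanating from $\eta$. For characteristics $x_1,x_2$ put $$\omega^{x_1,x_2}(s)=\frac{u(x_2(s),s)-u(x_1(s),s)}{x_2(s)-x_1(s)}.$$ Let $I$ be the set of $\zeta\in\mathbb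 R$ at which $u_0'(\zeta)$ exists and equals $w_0(\zeta)$, let $T_\zeta=\infty$ if $w_0(\zeta)\ge0$ and $T_\zeta=-2/w_0(\zeta)$ otherwise. For $0<t<\infty$ let $I_t=\{\zeta\in I: w_0(\zeta)>-2/t\}$, let $I_t^{unique}$ be the set of $\zeta\in I_t$ such that all characteristics emanating from $\zeta$ coincide on $[0,t]$, let $J$ be the set of $\zeta\in I$ for which some characteristic $x_\zeta$ on $[0,T_\zeta)$ emanating from $\zeta$ is such that $\partial_xu(x_\zeta(s),s)$ exists for a.e. $s\in[0,T_\zeta)$, and let $J_t^{unique}=I_t^{unique}\cap J$. **Lemma.** Let $u$ be any weak solution and let $0<\tau<t<\infty$. For almost every $\zeta\in J_t^{unique}$ there exist $M>0$ and $\varepsilon>0$ such that, with $x_\zeta$ the unique characteristic on $[0,t]$ emanating from $\zeta$ and $x_l[\eta]$ the leftmost characteristic on $[0,t]$ emanating from $\eta$, $$\omega^{x_\zeta,x_l[\eta]}(s)\le M\qquad\text{for every }\eta\in(\zeta,\zeta+\varepsilon]\text{ and every }s\in[0,\tau].$$ -/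

import Mathlib

open MeasureTheory Set
open scoped ContDiff NNReal ENNReal

namespace HunterSaxton

noncomputable section

/-- The spatial derivative `w = ∂ₓ u` at `(x, t)`. For a function that is absolutely continuous in
`x` it is the classical derivative for almost every `x` (and `0` where this does not exist). -/
def wx (u : ℝ → ℝ → ℝ) (x t : ℝ) : ℝ := deriv (fun y => u y t) x

/-- `∂ₜ u + ∂ₓ (u² / 2) = (1/2) ∫_{-∞}^x w² dy` in the sense of distributions
on the open half-plane `t > 0`. -/
def SolvesDistributionally (u : ℝ → ℝ → ℝ) : Prop :=
  ∀ φ : ℝ × ℝ → ℝ, ContDiff ℝ ∞ φ → HasCompactSupport φ → tsupport φ ⊆ {p | 0 < p.2} →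
    ∫ p : ℝ × ℝ,
      (u p.1 p.2 * deriv (fun s => φ (p.1, s)) p.2
        + (1 / 2) * u p.1 p.2 ^ 2 * deriv (fun y => φ (y, p.2)) p.1
        + (1 / 2) * (∫ y in Iic p.1, wx u y p.2 ^ 2) * φ p) = 0

/-- `u` (written `u x t`, only `t ≥ 0` matters) is a weak solution of the Hunter-Saxton equation
with initial datum `u₀`, where `w₀` is a square integrable representative of `u₀'`. -/
structure IsWeakSolution (u : ℝ → ℝ → ℝ) (u₀ w₀ : ℝ → ℝ) : Prop where
  continuousOn : ContinuousOn (fun p : ℝ × ℝ => u p.1 p.2) {p | 0 ≤ p.2}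
  absolutelyContinuous_space : ∀ t, 0 ≤ t → ∀ a b : ℝ,
    AbsolutelyContinuousOnInterval (fun x => u x t) a b
  /-- `w` maps `[0, ∞)` into `L²(ℝ)` … -/
  memLp_wx : ∀ t, 0 ≤ t → MemLp (fun x => wx u x t) 2 volume
  /-- … and is essentially bounded in time. -/
  essBounded_wx : ∃ C : ℝ≥0, ∀ᵐ t ∂(volume.restrict (Ici (0 : ℝ))),
    eLpNorm (fun x => wx u x t) 2 volume ≤ C
  /-- `t ↦ u(·, t)` is absolutely continuous on compact time intervals with values in
  `L²(-R, R)`, for every `R`. -/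
  absolutelyContinuous_time : ∀ R : ℝ, 0 < R →
    ∃ U : ℝ → Lp ℝ 2 (volume.restrict (Icc (-R) R)),
      (∀ t, 0 ≤ t → U t =ᵐ[volume.restrict (Icc (-R) R)] fun x => u x t) ∧
      ∀ T, 0 ≤ T → AbsolutelyContinuousOnInterval U 0 T
  equation : SolvesDistributionally u
  initial : ∀ x, u x 0 = u₀ x
  hasDerivAt_initial : ∀ᵐ x, HasDerivAt u₀ (w₀ x) x
  memLp_initial : MemLp w₀ 2 volume

/-- `x` is, on `[0, T]`, a characteristic of `u` emanating from `ζ`. -/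
def IsCharacteristic (u : ℝ → ℝ → ℝ) (T ζ : ℝ) (x : ℝ → ℝ) : Prop :=
  (∃ K : ℝ≥0, LipschitzOnWith K x (Icc 0 T)) ∧
  (∀ᵐ s ∂(volume.restrict (Icc 0 T)), HasDerivAt x (u (x s) s) s) ∧
  x 0 = ζ

/-- The leftmost characteristic `x_l[η]` on `[0, T]`: the pointwise infimum of all
characteristics on `[0, T]` that emanate from `η`. -/
def leftmostChar (u : ℝ → ℝ → ℝ) (T η s : ℝ) : ℝ :=
  sInf {y | ∃ x, IsCharacteristic u T η x ∧ x s = y}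

/-- The difference quotient `ω^{x₁,x₂}(s) = (u(x₂(s),s) - u(x₁(s),s)) / (x₂(s) - x₁(s))`. -/
def omega (u : ℝ → ℝ → ℝ) (x₁ x₂ : ℝ → ℝ) (s : ℝ) : ℝ :=
  (u (x₂ s) s - u (x₁ s) s) / (x₂ s - x₁ s)

/-- The set `I` of points where `u₀'` exists and equals `w₀`. -/
def setI (u₀ w₀ : ℝ → ℝ) : Set ℝ := {ζ | HasDerivAt u₀ (w₀ ζ) ζ}

/-- The set `I_t = {ζ ∈ I : w₀(ζ) > -2/t}`, for finite `t > 0`. -/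
def setIt (u₀ w₀ : ℝ → ℝ) (t : ℝ) : Set ℝ := {ζ | ζ ∈ setI u₀ w₀ ∧ -2 / t < w₀ ζ}

/-- The time `T_ζ`: `∞` if `w₀(ζ) ≥ 0`, and `-2 / w₀(ζ)` otherwise. -/
def lifeTime (w₀ : ℝ → ℝ) (ζ : ℝ) : EReal :=
  if 0 ≤ w₀ ζ then ⊤ else ((-2 / w₀ ζ : ℝ) : EReal)

/-- The set `I_t^unique` of points of `I_t` such that any two characteristics emanating from the
point coincide up to time `t`. -/
def setItUnique (u : ℝ → ℝ → ℝ) (u₀ w₀ : ℝ → ℝ) (t : ℝ) : Set ℝ :=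
  {ζ | ζ ∈ setIt u₀ w₀ t ∧
    ∀ x y, IsCharacteristic u t ζ x → IsCharacteristic u t ζ y → EqOn x y (Icc 0 t)}

/-- The set `Γ` of points `(x, t)` where `∂ₓ u(x, t)` exists. -/
def setGamma (u : ℝ → ℝ → ℝ) : Set (ℝ × ℝ) := {p | DifferentiableAt ℝ (fun y => u y p.2) p.1}

/-- The set `J` of points `ζ ∈ I` with a characteristic `x_ζ` on `[0, T_ζ)` such that
`(x_ζ(s), s) ∈ Γ` for almost every `s ∈ [0, T_ζ)`. -/
def setJ (u : ℝ → ℝ → ℝ) (u₀ w₀ : ℝ → ℝ) : Set ℝ :=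
  {ζ | ζ ∈ setI u₀ w₀ ∧ ∃ x : ℝ → ℝ,
    (∀ T : ℝ, 0 ≤ T → (T : EReal) < lifeTime w₀ ζ → IsCharacteristic u T ζ x) ∧
    ∀ᵐ s : ℝ, 0 ≤ s → (s : EReal) < lifeTime w₀ ζ → (x s, s) ∈ setGamma u}

/-- `J_t^unique = I_t^unique ∩ J`. -/
def setJtUnique (u : ℝ → ℝ → ℝ) (u₀ w₀ : ℝ → ℝ) (t : ℝ) : Set ℝ :=
  setItUnique u u₀ w₀ t ∩ setJ u u₀ w₀

end

end HunterSaxton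

namespace HunterSaxton

open Filter Topology

/-! Along a characteristic, `u` changes at the rate of half the energy to its left
(`IsEnergySolution.sub_eq_integral`). Let `h` be the distance of two characteristics and `p = h'`
the difference of the values of `u` on them. The energy lying between them is at least `p ^ 2 / h`
by Cauchy–Schwarz, so `p' ≥ p ^ 2 / (2 * h)` in integrated form (`IsEnergySolution.riccati`). This
says that `√h` is convex.

Convexity is used twice in `IsEnergySolution.curve_estimates`. The tangent of `√h` at time `0` has
relative slope `ω(0) / 2 > -1 / t`, which keeps `√h(s)` above `(1 - τ / t) * √h(0)` for `s ≤ τ`. The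
tangent at time `s`, followed up to time `t`, stays below `√h(t)`; a large `ω(s)` would therefore
force `h(t) / h(0)` to be large.

It remains to bound `h(t) / h(0)` as `η` decreases to `ζ`. Since characteristics can be spliced
where they meet, the largest endpoint at time `t` is a monotone function of the starting point
(`IsEnergySolution.monotone_maxEndpoint`), hence differentiable at almost every `ζ`. Uniqueness of
the characteristic from `ζ` identifies its endpoint with the maximal one, and differentiability
gives `h(t) ≤ L * h(0)`. The resulting estimates are uniform over all characteristics from `η` and
are closed conditions on the position at time `s`, so they pass to the infimum defining the leftmost
characteristic. -/

/-! ### Convexity of the square root under an integrated Riccati inequality. -/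

/-- The quotient is twice the derivative of `√h`, and formally its own derivative is `(p' - p ^ 2 /
(2 * h)) / √h ≥ 0`. As `p` need not be differentiable, one-sided slopes are compared instead. -/
theorem div_sqrt_le_of_riccati {h p : ℝ → ℝ} {a b : ℝ} (hh : Continuous h) (hp : Continuous p)
    (hder : ∀ x ∈ Ico a b, HasDerivWithinAt h (p x) (Ici x) x) (hpos : ∀ x ∈ Icc a b, 0 < h x)
    (hR : ∀ x ∈ Icc a b, ∀ y ∈ Icc a b, x ≤ y →
      1 / 2 * ∫ s in x..y, p s ^ 2 / h s ≤ p y - p x) :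
    ∀ x ∈ Icc a b, p a / √(h a) ≤ p x / √(h x) := by
  have key := image_le_of_liminf_slope_right_le_deriv_boundary (f := fun x => -(p x / √(h x)))
    (a := a) (b := b) (B := fun _ => -(p a / √(h a))) (B' := fun _ => 0)
    (ContinuousOn.neg (ContinuousOn.div hp.continuousOn (hh.sqrt).continuousOn
      (fun x hx => (Real.sqrt_pos.2 (hpos x hx)).ne'))) le_rfl continuousOn_const
    (fun x _ => hasDerivWithinAt_const _ _ _) ?_
  · intro x hx
    exact neg_le_neg_iff.1 (key hx)
  intro x hx r hr
  have hx' : x ∈ Icc a b := ⟨hx.1, hx.2.le⟩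
  have hpx := hpos x hx'
  have hsx := Real.sqrt_pos.2 hpx
  -- Replacing `p z` by its Riccati lower bound gives a differentiable function that lies above the
  -- original one to the right of `x`, touches it at `x`, and has right derivative zero there.
  set c : ℝ → ℝ := fun z => -((p x + 1 / 2 * ∫ s in x..z, p s ^ 2 / h s) / √(h z)) with hc
  have hI : HasDerivAt (fun z => ∫ s in x..z, p s ^ 2 / h s) (p x ^ 2 / h x) x := by
    apply intervalIntegral.integral_hasDerivAt_right
    · exact IntervalIntegrable.refl
    · exact ((hp.measurable.pow_const 2).div hh.measurable).stronglyMeasurable.stronglyMeasurableAtFilter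
    · exact (hp.continuousAt.pow 2).div hh.continuousAt hpx.ne'
  have hcd : HasDerivWithinAt c 0 (Ici x) x := by
    have h1 := (((hI.hasDerivWithinAt (s := Ici x)).const_mul (1 / 2)).const_add (p x)).div
      ((hder x hx).sqrt hpx.ne') hsx.ne'
    refine h1.neg.congr_deriv ?_
    have : √(h x) ^ 2 = h x := Real.sq_sqrt hpx.le
    simp only [intervalIntegral.integral_same, mul_zero, add_zero]
    field_simp
    rw [this]; ring
  have hsl := (hasDerivWithinAt_iff_tendsto_slope.1 hcd).eventually (gt_mem_nhds hr)
  have hset : Ici x \ {x} = Ioi x := by ext; simp [lt_iff_le_and_ne]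
  rw [hset] at hsl
  refine Eventually.frequently ?_
  filter_upwards [hsl, Ioo_mem_nhdsGT hx.2] with z hz hzb
  refine lt_of_le_of_lt ?_ hz
  have hz' : z ∈ Icc a b := ⟨hx.1.trans hzb.1.le, hzb.2.le⟩
  have hsz := Real.sqrt_pos.2 (hpos z hz')
  rw [slope_def_field, slope_def_field]
  have hzx : 0 < z - x := sub_pos.2 hzb.1
  gcongr
  · simp only [hc]
    have := hR x hx' z hz' hzb.1.le
    have : p x + 1 / 2 * ∫ s in x..z, p s ^ 2 / h s ≤ p z := by linarith
    gcongr
  · simp [hc]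

/-- A convex function lies above its tangent: the left side is the tangent of `√h` at `a`, of slope
`p a / (2 * √(h a))`, evaluated at `b`. -/
theorem sqrt_ge_affine_of_riccati {h p : ℝ → ℝ} {a b : ℝ} (hab : a ≤ b) (hh : Continuous h)
    (hp : Continuous p)
    (hder : ∀ x ∈ Ico a b, HasDerivWithinAt h (p x) (Ici x) x) (hpos : ∀ x ∈ Icc a b, 0 < h x)
    (hR : ∀ x ∈ Icc a b, ∀ y ∈ Icc a b, x ≤ y →
      1 / 2 * ∫ s in x..y, p s ^ 2 / h s ≤ p y - p x) :
    √(h a) * (1 + p a / h a * (b - a) / 2) ≤ √(h b) := by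
  have hq := div_sqrt_le_of_riccati hh hp hder hpos hR
  have key := image_le_of_deriv_right_le_deriv_boundary
    (f := fun x => √(h a) + p a / √(h a) / 2 * (x - a)) (f' := fun _ => p a / √(h a) / 2)
    (a := a) (b := b) (B := fun x => √(h x)) (B' := fun x => p x / (2 * √(h x)))
    (by fun_prop) ?_ (by simp) hh.sqrt.continuousOn ?_ ?_ (right_mem_Icc.2 hab)
  · refine le_trans (le_of_eq ?_) key
    have hpa := hpos a (left_mem_Icc.2 hab)
    have hsa := Real.sqrt_pos.2 hpa
    have : √(h a) ^ 2 = h a := Real.sq_sqrt hpa.le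
    field_simp
    rw [this]
  · intro x _
    have := (((hasDerivAt_id x).sub_const a).const_mul (p a / √(h a) / 2)).const_add (√(h a))
    simpa using this.hasDerivWithinAt
  · intro x hx
    exact (hder x hx).sqrt (hpos x ⟨hx.1, hx.2.le⟩).ne'
  · intro x hx
    have := hq x ⟨hx.1, hx.2.le⟩
    calc p a / √(h a) / 2 ≤ p x / √(h x) / 2 := by gcongr
      _ = _ := by rw [div_div, mul_comm]

/-- A nonnegative function whose square root is convex where it is positive stays positive as long
as its tangent line does. -/
theorem pos_of_riccati {h p : ℝ → ℝ} {a b : ℝ} (hh : Continuous h)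
    (hp : Continuous p) (hder : ∀ x ∈ Ico a b, HasDerivWithinAt h (p x) (Ici x) x)
    (ha : 0 < h a) (hω : 0 < 1 + p a / h a * (b - a) / 2)
    (hR : ∀ x ∈ Icc a b, ∀ y ∈ Icc a b, x ≤ y → (∀ s ∈ Icc x y, 0 < h s) →
      1 / 2 * ∫ s in x..y, p s ^ 2 / h s ≤ p y - p x) :
    ∀ x ∈ Icc a b, 0 < h x := by
  by_contra! hcon
  obtain ⟨x₀, hx₀, hx₀'⟩ := hcon
  have hK : IsCompact (Icc a b ∩ {x | h x ≤ 0}) :=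
    isCompact_Icc.inter_right (isClosed_le hh continuous_const)
  -- At the first zero `c` the tangent bound, valid before `c`, survives in the limit and
  -- contradicts `√(h c) = 0`.
  obtain ⟨c, ⟨hc, hc0⟩, hmin⟩ := hK.exists_isLeast ⟨x₀, hx₀, hx₀'⟩
  have hc0' : h c ≤ 0 := hc0
  have hac : a < c := lt_of_le_of_ne hc.1 (by rintro rfl; linarith)
  have hlt : ∀ x ∈ Ico a c, 0 < h x := by
    intro x hx
    by_contra! hx'
    exact absurd (hmin ⟨⟨hx.1, hx.2.le.trans hc.2⟩, hx'⟩) (not_le.2 hx.2)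
  have hbd : ∀ x ∈ Ico a c, √(h a) * (1 + p a / h a * (x - a) / 2) ≤ √(h x) := by
    intro x hx
    refine sqrt_ge_affine_of_riccati hx.1 hh hp (fun y hy => hder y ⟨hy.1, ?_⟩) ?_ ?_
    · linarith [hy.2, hx.2, hc.2]
    · intro y hy; exact hlt y ⟨hy.1, hy.2.trans_lt hx.2⟩
    · intro y hy z hz hyz
      exact hR y ⟨hy.1, by linarith [hy.2, hx.2, hc.2]⟩ z ⟨hz.1, by linarith [hz.2, hx.2, hc.2]⟩ hyz
        (fun s hs => hlt s ⟨hy.1.trans hs.1, by linarith [hs.2, hz.2, hx.2]⟩)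
  have hlim : √(h a) * (1 + p a / h a * (c - a) / 2) ≤ √(h c) := by
    have h1 : Tendsto (fun x => √(h a) * (1 + p a / h a * (x - a) / 2)) (𝓝[<] c)
        (𝓝 (√(h a) * (1 + p a / h a * (c - a) / 2))) :=
      (Continuous.tendsto (by fun_prop) c).mono_left nhdsWithin_le_nhds
    have h2 : Tendsto (fun x => √(h x)) (𝓝[<] c) (𝓝 (√(h c))) :=
      (hh.sqrt.tendsto c).mono_left nhdsWithin_le_nhds
    refine le_of_tendsto_of_tendsto h1 h2 ?_
    filter_upwards [Ioo_mem_nhdsLT hac] with x hx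
    exact hbd x ⟨hx.1.le, hx.2⟩
  rw [Real.sqrt_eq_zero_of_nonpos hc0'] at hlim
  have hpos : 0 < 1 + p a / h a * (c - a) / 2 := by
    rcases le_total 0 (p a / h a) with h0 | h0
    · have := mul_nonneg h0 (sub_nonneg.2 hac.le); linarith
    · have : p a / h a * (b - a) ≤ p a / h a * (c - a) :=
        mul_le_mul_of_nonpos_left (by linarith [hc.2]) h0
      linarith
  have := mul_pos (Real.sqrt_pos.2 ha) hpos
  linarith

/-! ### Peano existence for continuous fields of linear growth. -/

/-- Integral curves of the time dependent vector field `v` on `[0, T]`, as continuous functions. -/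
structure IsCurve (v : ℝ → ℝ → ℝ) (T : ℝ) (X : ℝ → ℝ) : Prop where
  continuous : Continuous X
  integral_eq : ∀ a ∈ Icc 0 T, ∀ b ∈ Icc 0 T, X b - X a = ∫ s in a..b, v (X s) s

/-- The explicit Euler scheme with step `δ`. -/
def eulerSeq (v : ℝ → ℝ → ℝ) (δ η : ℝ) : ℕ → ℝ
  | 0 => η
  | k + 1 => eulerSeq v δ η k + δ * v (eulerSeq v δ η k) (k * δ)

/-- Taking `c = 0` yields a Lipschitz bound uniform in the step; taking for `c` the velocity at a
limit point yields the derivative there. -/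
theorem eulerSeq_increment {v : ℝ → ℝ → ℝ} {δ η c ε : ℝ} (hδ : 0 ≤ δ) {i j : ℕ} (hij : i ≤ j)
    (h : ∀ k, i ≤ k → k < j → |v (eulerSeq v δ η k) (k * δ) - c| ≤ ε) :
    |eulerSeq v δ η j - eulerSeq v δ η i - (j * δ - i * δ) * c| ≤ (j * δ - i * δ) * ε := by
  induction j, hij using Nat.le_induction with
  | base => simp
  | succ j hij ih =>
    have ih' := ih (fun k hk hkj => h k hk (by omega))
    have hj := h j hij (by omega)
    rw [abs_le] at ih' hj ⊢
    simp only [eulerSeq]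
    push_cast
    have h1 := mul_le_mul_of_nonneg_left hj.1 hδ
    have h2 := mul_le_mul_of_nonneg_left hj.2 hδ
    constructor <;> nlinarith

theorem exists_right_derivative_of_bounded {v : ℝ → ℝ → ℝ}
    (hv : Continuous fun p : ℝ × ℝ => v p.1 p.2) {K : ℝ} (hK : ∀ x s, |v x s| ≤ K) (η : ℝ) :
    ∃ X : ℝ → ℝ, X 0 = η ∧ ContinuousOn X (Ici 0) ∧
      ∀ s, 0 ≤ s → HasDerivWithinAt X (v (X s) s) (Ici s) s := by
  have hK0 : 0 ≤ K := (abs_nonneg _).trans (hK 0 0)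
  set N : ℕ → ℝ → ℕ := fun n s => ⌊s * ((n : ℝ) + 1)⌋₊ with hN
  set δ : ℕ → ℝ := fun n => 1 / ((n : ℝ) + 1) with hδ
  have hδ0 : ∀ n, 0 < δ n := fun n => by simp only [hδ]; positivity
  have hδlim : Tendsto δ atTop (𝓝 0) := tendsto_one_div_add_atTop_nhds_zero_nat
  set x : ℕ → ℝ → ℝ := fun n s => eulerSeq v (δ n) η (N n s) with hx
  have hNle : ∀ n s, 0 ≤ s → (N n s : ℝ) * δ n ≤ s := by
    intro n s hs
    have := Nat.floor_le (a := s * ((n : ℝ) + 1)) (by positivity)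
    simp only [hN, hδ, mul_one_div]
    rw [div_le_iff₀ (by positivity)]
    exact this
  have hNge : ∀ n s, s ≤ (N n s : ℝ) * δ n + δ n := by
    intro n s
    have := (Nat.lt_floor_add_one (s * ((n : ℝ) + 1))).le
    simp only [hN, hδ, mul_one_div, ← add_div]
    rw [le_div_iff₀ (by positivity)]
    exact this
  have hNmono : ∀ n {a b : ℝ}, a ≤ b → N n a ≤ N n b := by
    intro n a b hab
    exact Nat.floor_mono (mul_le_mul_of_nonneg_right hab (by positivity))
  have hNlim : ∀ s, 0 ≤ s → Tendsto (fun n => (N n s : ℝ) * δ n) atTop (𝓝 s) := by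
    intro s hs
    refine tendsto_of_tendsto_of_tendsto_of_le_of_le (g := fun n => s - δ n) (h := fun _ => s)
      ?_ tendsto_const_nhds (fun n => ?_) (fun n => hNle n s hs)
    · simpa using tendsto_const_nhds.sub hδlim
    · have := hNge n s
      simp only; linarith
  have hinc : ∀ n {i j : ℕ}, i ≤ j →
      |eulerSeq v (δ n) η j - eulerSeq v (δ n) η i| ≤ (j * δ n - i * δ n) * K := by
    intro n i j hij
    simpa using eulerSeq_increment (v := v) (η := η) (c := 0) (ε := K) (hδ0 n).le hij
      (fun k _ _ => by simpa using hK _ _)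
  have hbdd : ∀ n s, x n s ∈ Icc (η - |s| * K) (η + |s| * K) := by
    intro n s
    have h1 := hinc n (Nat.zero_le (N n s))
    have h2 : (N n s : ℝ) * δ n ≤ |s| :=
      (mul_le_mul_of_nonneg_right (by exact_mod_cast hNmono n (le_abs_self s)) (hδ0 n).le).trans
        (hNle n _ (abs_nonneg s))
    have h3 := mul_le_mul_of_nonneg_right h2 hK0
    simp only [eulerSeq, Nat.cast_zero, zero_mul, sub_zero] at h1
    rw [abs_le] at h1
    simp only [hx]
    constructor <;> linarith [h1.1, h1.2]
  -- Bounded sequences converge along an ultrafilter, so one choice gives the limit at all times at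
  -- once, in place of an Arzelà–Ascoli subsequence.
  set U : Ultrafilter ℕ := hyperfilter ℕ
  have hU : (U : Filter ℕ) ≤ atTop := Nat.hyperfilter_le_atTop
  have hex : ∀ s, ∃ L, Tendsto (fun n => x n s) U (𝓝 L) := by
    intro s
    obtain ⟨L, -, hL⟩ := isCompact_Icc.ultrafilter_le_nhds (U.map fun n => x n s)
      (le_principal_iff.2 (Filter.univ_mem' (f := (U : Filter ℕ)) (fun n => hbdd n s)))
    exact ⟨L, hL⟩
  choose X hX using hex
  have hest : ∀ {a b c ε : ℝ}, 0 ≤ a → a ≤ b →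
      (∀ᶠ n in (U : Filter ℕ), ∀ k, N n a ≤ k → k < N n b →
        |v (eulerSeq v (δ n) η k) (k * δ n) - c| ≤ ε) →
      |X b - X a - (b - a) * c| ≤ (b - a) * ε := by
    intro a b c ε ha hab h
    have hN1 := (hNlim a ha).mono_left hU
    have hN2 := (hNlim b (ha.trans hab)).mono_left hU
    refine le_of_tendsto_of_tendsto
      ((((hX b).sub (hX a)).sub ((hN2.sub hN1).mul_const c)).abs) ((hN2.sub hN1).mul_const ε) ?_
    filter_upwards [h] with n hn
    exact eulerSeq_increment (hδ0 n).le (hNmono n hab) hn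
  have hlip : ∀ {a b : ℝ}, 0 ≤ a → a ≤ b → |X b - X a| ≤ (b - a) * K := by
    intro a b ha hab
    simpa using hest (c := 0) (ε := K) ha hab
      (Eventually.of_forall fun n k _ _ => by simpa using hK _ _)
  refine ⟨X, ?_, ?_, ?_⟩
  · refine tendsto_nhds_unique (hX 0) ?_
    simp [hx, hN, eulerSeq]
  · refine (LipschitzOnWith.of_dist_le_mul (K := K.toNNReal) ?_).continuousOn
    intro a ha b hb
    rw [Real.coe_toNNReal _ hK0, Real.dist_eq, Real.dist_eq]
    rcases le_total a b with hab | hab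
    · rw [abs_sub_comm, abs_sub_comm a b, abs_of_nonneg (sub_nonneg.2 hab), mul_comm]
      exact hlip ha hab
    · rw [abs_of_nonneg (sub_nonneg.2 hab), mul_comm]
      exact hlip hb hab
  · intro a ha
    rw [hasDerivWithinAt_iff_isLittleO, Asymptotics.isLittleO_iff]
    intro ε hε
    obtain ⟨ρ, hρ, hρv⟩ := Metric.continuousAt_iff.1 (hv.continuousAt (x := (X a, a))) ε hε
    -- Both `b - a` and the step are kept below this length. The first node may precede `a` by one
    -- step, so a node moves by at most twice this length times `K`, hence by at most `ρ / 2`;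
    -- another `ρ / 4` pays for the convergence at `a`.
    have hρ' : 0 < ρ / (4 * (K + 1)) := by positivity
    have hKρ : ρ / (4 * (K + 1)) * (K + 1) = ρ / 4 := by field_simp
    have hρ4 : ρ / (4 * (K + 1)) ≤ ρ / 4 := by
      rw [← hKρ]; nlinarith
    filter_upwards [Icc_mem_nhdsGE (show a < a + ρ / (4 * (K + 1)) by linarith)] with b hb
    have hab := hb.1
    simp only [smul_eq_mul, Real.norm_eq_abs, abs_of_nonneg (sub_nonneg.2 hab)]
    rw [mul_comm ε]
    refine hest ha hab ?_
    have e1 : ∀ᶠ n in (U : Filter ℕ), dist (x n a) (X a) < ρ / 4 :=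
      (hX a).eventually (Metric.ball_mem_nhds _ (by positivity))
    have e2 : ∀ᶠ n in (U : Filter ℕ), δ n < ρ / (4 * (K + 1)) :=
      hU (hδlim.eventually (gt_mem_nhds hρ'))
    filter_upwards [e1, e2] with n h1 h2 k hk1 hk2
    have hkb : (k : ℝ) * δ n ≤ b :=
      (mul_le_mul_of_nonneg_right (by exact_mod_cast hk2.le) (hδ0 n).le).trans
        (hNle n b (ha.trans hab))
    have hka : (N n a : ℝ) * δ n ≤ k * δ n :=
      mul_le_mul_of_nonneg_right (by exact_mod_cast hk1) (hδ0 n).le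
    have hNa := hNge n a
    have h3 := hinc n hk1
    have h4 : (k * δ n - N n a * δ n) * K ≤ (2 * (ρ / (4 * (K + 1)))) * K :=
      mul_le_mul_of_nonneg_right (by linarith [hb.2]) hK0
    have h5 : |eulerSeq v (δ n) η k - X a| < ρ := by
      have h6 : |x n a - X a| < ρ / 4 := h1
      have : |eulerSeq v (δ n) η k - X a| ≤
          |eulerSeq v (δ n) η k - eulerSeq v (δ n) η (N n a)| + |x n a - X a| :=
        abs_sub_le _ _ _
      nlinarith
    have h6 : |(k : ℝ) * δ n - a| < ρ := by
      rw [abs_lt]; constructor <;> linarith [hb.2]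
    have := hρv (x := (eulerSeq v (δ n) η k, (k : ℝ) * δ n)) (by
      rw [Prod.dist_eq, max_lt_iff]; exact ⟨h5, h6⟩)
    exact (Real.dist_eq _ _ ▸ this).le

theorem IsCurve.hasDerivWithinAt {v : ℝ → ℝ → ℝ} (hv : Continuous fun p : ℝ × ℝ => v p.1 p.2)
    {T : ℝ} {X : ℝ → ℝ} (hX : IsCurve v T X) {s : ℝ} (hs : s ∈ Icc 0 T) :
    HasDerivWithinAt X (v (X s) s) (Icc 0 T) s := by
  have hc : Continuous fun s => v (X s) s := hv.comp (hX.continuous.prodMk continuous_id)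
  have h1 : HasDerivAt (fun b => X s + ∫ r in s..b, v (X r) r) (v (X s) s) s :=
    (intervalIntegral.integral_hasDerivAt_right (hc.intervalIntegrable _ _)
      hc.stronglyMeasurable.stronglyMeasurableAtFilter hc.continuousAt).const_add _
  refine h1.hasDerivWithinAt.congr_of_mem (fun b hb => ?_) hs
  have := hX.integral_eq s hs b hb
  linarith

theorem IsCurve.hasDerivWithinAt_Ici {v : ℝ → ℝ → ℝ} (hv : Continuous fun p : ℝ × ℝ => v p.1 p.2)
    {T : ℝ} {X : ℝ → ℝ} (hX : IsCurve v T X) {s : ℝ} (hs : s ∈ Ico 0 T) :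
    HasDerivWithinAt X (v (X s) s) (Ici s) s := by
  refine (hX.hasDerivWithinAt hv ⟨hs.1, hs.2.le⟩).mono_of_mem_nhdsWithin ?_
  filter_upwards [Icc_mem_nhdsGE hs.2] with r hr
  exact ⟨hs.1.trans hr.1, hr.2⟩

theorem IsCurve.abs_le {v : ℝ → ℝ → ℝ} (hv : Continuous fun p : ℝ × ℝ => v p.1 p.2)
    {T K : ℝ} (hK0 : 0 ≤ K) (hK : ∀ s ∈ Icc 0 T, ∀ x, |v x s| ≤ K * (1 + |x|)) {X : ℝ → ℝ}
    (hX : IsCurve v T X) {s : ℝ} (hs : s ∈ Icc 0 T) :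
    |X s| ≤ gronwallBound |X 0| K K T := by
  have := norm_le_gronwallBound_of_norm_deriv_right_le (f := X) (δ := |X 0|) (K := K) (ε := K)
    hX.continuous.continuousOn (fun x hx => hX.hasDerivWithinAt_Ici hv hx) le_rfl
    (fun x hx => by
      have := hK x ⟨hx.1, hx.2.le⟩ (X x)
      simp only [Real.norm_eq_abs]; linarith) s hs
  refine this.trans ?_
  exact gronwallBound_mono (abs_nonneg _) hK0 hK0 (by linarith [hs.2])

/-- Clamping `x` to the Grönwall radius and `s` to `[0, T]` makes the field bounded. The clamped
field obeys the same growth bound, so its curve never leaves the region where clamping changes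
nothing. -/
theorem exists_isCurve {v : ℝ → ℝ → ℝ} (hv : Continuous fun p : ℝ × ℝ => v p.1 p.2)
    {T K : ℝ} (hT : 0 ≤ T) (hK0 : 0 ≤ K) (hK : ∀ s ∈ Icc 0 T, ∀ x, |v x s| ≤ K * (1 + |x|))
    (η : ℝ) : ∃ X, IsCurve v T X ∧ X 0 = η := by
  set R := gronwallBound |η| K K T with hR
  have hR0 : 0 ≤ R := by
    have := gronwallBound_mono (abs_nonneg η) hK0 hK0 hT
    rw [gronwallBound_x0] at this
    exact (abs_nonneg η).trans this
  set cR : ℝ → ℝ := fun x => max (-R) (min R x)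
  set cT : ℝ → ℝ := fun s => max 0 (min T s)
  have hcR : ∀ x, |cR x| ≤ R := fun x =>
    abs_le.2 ⟨le_max_left _ _, max_le (by linarith) (min_le_left _ _)⟩
  have hcR' : ∀ x, |x| ≤ R → cR x = x := fun x hx => by
    rw [abs_le] at hx
    simp only [cR, min_eq_right hx.2, max_eq_right hx.1]
  have hcR'' : ∀ x, |cR x| ≤ |x| := fun x => by
    rcases le_total |x| R with h | h
    · rw [hcR' x h]
    · exact (hcR x).trans h
  have hcT : ∀ s, cT s ∈ Icc 0 T := fun s => ⟨le_max_left _ _, max_le hT (min_le_left _ _)⟩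
  have hcT' : ∀ s ∈ Icc 0 T, cT s = s := fun s hs => by
    simp only [cT, min_eq_right hs.2, max_eq_right hs.1]
  set w : ℝ → ℝ → ℝ := fun x s => v (cR x) (cT s) with hw
  have hwc : Continuous fun p : ℝ × ℝ => w p.1 p.2 :=
    hv.comp (f := fun p : ℝ × ℝ => (cR p.1, cT p.2)) (by fun_prop)
  have hwb : ∀ x s, |w x s| ≤ K * (1 + R) := fun x s =>
    (hK _ (hcT s) _).trans (by gcongr; exact hcR x)
  obtain ⟨Y, hY0, hYc, hYd⟩ := exists_right_derivative_of_bounded hwc hwb η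
  set X : ℝ → ℝ := fun s => Y (cT s) with hXdef
  have hXY : ∀ s ∈ Icc 0 T, X s = Y s := fun s hs => by simp only [hXdef, hcT' s hs]
  have hXcurve : IsCurve w T X := by
    refine ⟨?_, ?_⟩
    · exact hYc.comp_continuous (by fun_prop) (fun s => (hcT s).1)
    · have key : ∀ a ∈ Icc 0 T, ∀ b ∈ Icc 0 T, a ≤ b → X b - X a = ∫ s in a..b, w (X s) s := by
        intro a ha b hb hab
        have hsub : Icc a b ⊆ Icc 0 T := Icc_subset_Icc ha.1 hb.2
        have h1 : ∫ s in a..b, w (Y s) s = Y b - Y a := by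
          refine intervalIntegral.integral_eq_sub_of_hasDeriv_right_of_le hab
            (hYc.mono fun s hs => ha.1.trans hs.1)
            (fun s hs => (hYd s (ha.1.trans hs.1.le)).mono Ioi_subset_Ici_self) ?_
          refine ContinuousOn.intervalIntegrable ?_
          rw [uIcc_of_le hab]
          exact hwc.comp_continuousOn
            ((hYc.mono fun s hs => ha.1.trans hs.1).prodMk continuousOn_id)
        rw [hXY a ha, hXY b hb, ← h1]
        refine intervalIntegral.integral_congr fun s hs => ?_
        rw [uIcc_of_le hab] at hs
        simp only [hXY s (hsub hs)]
      intro a ha b hb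
      rcases le_total a b with hab | hab
      · exact key a ha b hb hab
      · rw [intervalIntegral.integral_symm, ← key b hb a ha hab]; ring
  have hX0 : X 0 = η := by rw [hXY 0 ⟨le_rfl, hT⟩, hY0]
  refine ⟨X, ⟨hXcurve.continuous, fun a ha b hb => ?_⟩, hX0⟩
  rw [hXcurve.integral_eq a ha b hb]
  refine intervalIntegral.integral_congr fun s hs => ?_
  have hs' : s ∈ Icc 0 T := (convex_Icc (0 : ℝ) T).ordConnected.uIcc_subset ha hb hs
  have hb := hXcurve.abs_le hwc hK0 (fun r hr x => (hK _ (hcT r) _).trans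
    (mul_le_mul_of_nonneg_left (by linarith [hcR'' x]) hK0)) hs'
  rw [hX0] at hb
  simp only [hw, hcT' s hs', hcR' _ hb]

/-! ### Smooth cutoffs and one-sided approximate identities. -/

/-- The derivative of `Real.smoothTransition`, a bump function of mass one supported in `[0, 1]`. -/
noncomputable def stepKernel : ℝ → ℝ := deriv Real.smoothTransition

theorem continuous_stepKernel : Continuous stepKernel :=
  (Real.smoothTransition.contDiff (n := 1)).continuous_deriv le_rfl

theorem stepKernel_eq_zero {r : ℝ} (hr : r ∉ Ioc (0 : ℝ) 1) : stepKernel r = 0 := by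
  rcases le_or_gt r 0 with h | h
  · refine IsLocalMin.deriv_eq_zero (Eventually.of_forall fun s => ?_)
    rw [Real.smoothTransition.zero_of_nonpos h]
    exact Real.smoothTransition.nonneg s
  · refine IsLocalMax.deriv_eq_zero (Eventually.of_forall fun s => ?_)
    have : 1 < r := by by_contra! h'; exact hr ⟨h, h'⟩
    rw [Real.smoothTransition.one_of_one_le this.le]
    exact Real.smoothTransition.le_one s

theorem hasCompactSupport_stepKernel : HasCompactSupport stepKernel :=
  HasCompactSupport.intro isCompact_Icc
    (fun _ hr => stepKernel_eq_zero (fun h => hr (Ioc_subset_Icc_self h)))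

theorem integrable_stepKernel : Integrable stepKernel :=
  continuous_stepKernel.integrable_of_hasCompactSupport hasCompactSupport_stepKernel

theorem integral_stepKernel : ∫ r, stepKernel r = 1 := by
  rw [← intervalIntegral.integral_eq_integral_of_support_subset (a := 0) (b := 1)
    (fun r hr => by by_contra h; exact hr (stepKernel_eq_zero h)), stepKernel,
    intervalIntegral.integral_deriv_eq_sub'  (f := Real.smoothTransition) rfl
      (fun x _ => (Real.smoothTransition.contDiff (n := 1)).differentiable one_ne_zero x)
      continuous_stepKernel.continuousOn]
  simp

/-- A smooth approximation of the indicator function of `(a, b]`. -/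
noncomputable def cutoff (n : ℕ) (a b s : ℝ) : ℝ :=
  Real.smoothTransition (((n : ℝ) + 1) * (s - a)) - Real.smoothTransition (((n : ℝ) + 1) * (s - b))

theorem contDiff_cutoff (n : ℕ) (a b : ℝ) : ContDiff ℝ ∞ (cutoff n a b) := by
  unfold cutoff
  exact (Real.smoothTransition.contDiff.comp (by fun_prop)).sub
    (Real.smoothTransition.contDiff.comp (by fun_prop))

theorem cutoff_nonneg (n : ℕ) {a b : ℝ} (hab : a ≤ b) (s : ℝ) : 0 ≤ cutoff n a b s :=
  sub_nonneg.2 (Real.smoothTransition.monotone (by gcongr))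

theorem cutoff_le_one (n : ℕ) (a b s : ℝ) : cutoff n a b s ≤ 1 := by
  have h1 := Real.smoothTransition.le_one (((n : ℝ) + 1) * (s - a))
  have h2 := Real.smoothTransition.nonneg (((n : ℝ) + 1) * (s - b))
  unfold cutoff; linarith

theorem cutoff_eq_zero (n : ℕ) {a b s : ℝ} (hab : a ≤ b) (hs : s ∉ Icc a (b + 1)) :
    cutoff n a b s = 0 := by
  unfold cutoff
  have hn : (1 : ℝ) ≤ n + 1 := by linarith [Nat.cast_nonneg (α := ℝ) n]
  rcases lt_or_ge s a with h | h
  · rw [Real.smoothTransition.zero_of_nonpos, Real.smoothTransition.zero_of_nonpos, sub_zero]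
    · exact mul_nonpos_of_nonneg_of_nonpos (by positivity) (by linarith)
    · exact mul_nonpos_of_nonneg_of_nonpos (by positivity) (by linarith)
  · have hb : b + 1 < s := by by_contra! h'; exact hs ⟨h, h'⟩
    rw [Real.smoothTransition.one_of_one_le, Real.smoothTransition.one_of_one_le, sub_self]
    · nlinarith
    · nlinarith

theorem tendsto_smoothTransition (x : ℝ) :
    Tendsto (fun n : ℕ => Real.smoothTransition (((n : ℝ) + 1) * x)) atTop
      (𝓝 (if 0 < x then 1 else 0)) := by
  split_ifs with h
  · obtain ⟨N, hN⟩ := exists_nat_gt (1 / x)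
    refine tendsto_const_nhds.congr' ?_
    filter_upwards [eventually_ge_atTop N] with n hn
    rw [Real.smoothTransition.one_of_one_le]
    have : (N : ℝ) ≤ n := by exact_mod_cast hn
    rw [div_lt_iff₀ h] at hN
    nlinarith
  · refine tendsto_const_nhds.congr fun n => ?_
    rw [Real.smoothTransition.zero_of_nonpos]
    exact mul_nonpos_of_nonneg_of_nonpos (by positivity) (not_lt.1 h)

/-- The limit is half-open because `Real.smoothTransition` vanishes at `0`, so each endpoint counts
as not yet passed. -/
theorem tendsto_cutoff {a b : ℝ} (hab : a ≤ b) (s : ℝ) :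
    Tendsto (fun n => cutoff n a b s) atTop (𝓝 ((Ioc a b).indicator 1 s)) := by
  have e : (Ioc a b).indicator (1 : ℝ → ℝ) s =
      (if 0 < s - a then 1 else 0) - if 0 < s - b then 1 else 0 := by
    by_cases h1 : a < s
    · by_cases h2 : b < s
      · simp [h1, h2]
      · simp [h1, h2, not_lt.1 h2]
    · have h2 : ¬ b < s := fun h => h1 (hab.trans_lt h)
      simp [h1, h2]
  rw [e]
  exact (tendsto_smoothTransition (s - a)).sub (tendsto_smoothTransition (s - b))

theorem deriv_cutoff (n : ℕ) (a b s : ℝ) : deriv (cutoff n a b) s =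
    ((n : ℝ) + 1) * stepKernel (((n : ℝ) + 1) * (s - a)) -
      ((n : ℝ) + 1) * stepKernel (((n : ℝ) + 1) * (s - b)) := by
  have h : ∀ c, HasDerivAt (fun s => Real.smoothTransition (((n : ℝ) + 1) * (s - c)))
      (((n : ℝ) + 1) * stepKernel (((n : ℝ) + 1) * (s - c))) s := by
    intro c
    have h1 : HasDerivAt Real.smoothTransition (stepKernel (((n : ℝ) + 1) * (s - c)))
        (((n : ℝ) + 1) * (s - c)) :=
      ((Real.smoothTransition.contDiff (n := 1)).differentiable one_ne_zero _).hasDerivAt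
    have h2 : HasDerivAt (fun s => ((n : ℝ) + 1) * (s - c)) ((n : ℝ) + 1) s := by
      simpa using ((hasDerivAt_id s).sub_const c).const_mul ((n : ℝ) + 1)
    rw [mul_comm]
    exact h1.comp s h2
  exact ((h a).sub (h b)).deriv

theorem continuous_deriv_cutoff (n : ℕ) (a b : ℝ) : Continuous (deriv (cutoff n a b)) :=
  (contDiff_cutoff n a b).continuous_deriv (by simp)

theorem deriv_cutoff_eq_zero (n : ℕ) {a b s : ℝ} (hab : a ≤ b) (hs : s ∉ Icc a (b + 1)) :
    deriv (cutoff n a b) s = 0 := by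
  have hn : (1 : ℝ) ≤ n + 1 := by linarith [Nat.cast_nonneg (α := ℝ) n]
  have : ∀ c ∈ Icc a b, stepKernel (((n : ℝ) + 1) * (s - c)) = 0 := by
    intro c hc
    refine stepKernel_eq_zero fun h => hs ⟨?_, ?_⟩
    · have := (mul_pos_iff_of_pos_left (by linarith)).1 h.1
      linarith [hc.1]
    · have := (mul_pos_iff_of_pos_left (by linarith)).1 h.1
      have h2 := h.2
      have : s - c ≤ 1 := by nlinarith
      linarith [hc.2]
  rw [deriv_cutoff, this a ⟨le_rfl, hab⟩, this b ⟨hab, le_rfl⟩]; ring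

theorem integrable_mul_kernel (n : ℕ) {g : ℝ → ℝ} (hg : Continuous g) (a : ℝ) :
    Integrable fun s => g s * (((n : ℝ) + 1) * stepKernel (((n : ℝ) + 1) * (s - a))) := by
  refine Continuous.integrable_of_hasCompactSupport ?_ ?_
  · have := continuous_stepKernel; fun_prop
  · refine HasCompactSupport.intro (isCompact_Icc (a := a) (b := a + 1)) fun s hs => ?_
    have hn : (1 : ℝ) ≤ n + 1 := by linarith [Nat.cast_nonneg (α := ℝ) n]
    rw [stepKernel_eq_zero, mul_zero, mul_zero]
    refine fun h => hs ⟨?_, ?_⟩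
    · have := (mul_pos_iff_of_pos_left (by linarith)).1 h.1
      linarith
    · have := (mul_pos_iff_of_pos_left (by linarith)).1 h.1
      have h2 := h.2
      have : s - a ≤ 1 := by nlinarith
      linarith

theorem integral_mul_kernel (n : ℕ) (g : ℝ → ℝ) (a : ℝ) :
    ∫ s, g s * (((n : ℝ) + 1) * stepKernel (((n : ℝ) + 1) * (s - a))) =
      ∫ r, g (a + r / ((n : ℝ) + 1)) * stepKernel r := by
  have hn : (0 : ℝ) < n + 1 := by positivity
  set H : ℝ → ℝ := fun r => g (a + r / ((n : ℝ) + 1)) * stepKernel r with hH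
  have h1 := Measure.integral_comp_mul_left H ((n : ℝ) + 1)
  have h2 := integral_sub_right_eq_self (μ := volume) (fun s => H (((n : ℝ) + 1) * s)) a
  rw [h1] at h2
  have h3 : ∀ s, g s * (((n : ℝ) + 1) * stepKernel (((n : ℝ) + 1) * (s - a))) =
      ((n : ℝ) + 1) * H (((n : ℝ) + 1) * (s - a)) := by
    intro s
    have : a + ((n : ℝ) + 1) * (s - a) / ((n : ℝ) + 1) = s := by field_simp; ring
    simp only [hH, this]; ring
  simp only [h3]
  rw [integral_const_mul, h2, abs_of_pos (by positivity), smul_eq_mul, ← mul_assoc,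
    mul_inv_cancel₀ hn.ne', one_mul]

theorem abs_integral_mul_kernel_le (n : ℕ) {g : ℝ → ℝ} {a M : ℝ}
    (hM : ∀ s ∈ Icc a (a + 1), |g s| ≤ M) :
    |∫ s, g s * (((n : ℝ) + 1) * stepKernel (((n : ℝ) + 1) * (s - a)))| ≤
      M * ∫ r, |stepKernel r| := by
  rw [integral_mul_kernel, ← integral_const_mul, ← Real.norm_eq_abs]
  refine norm_integral_le_of_norm_le (integrable_stepKernel.abs.const_mul M)
    (Eventually.of_forall fun r => ?_)
  rw [Real.norm_eq_abs, abs_mul]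
  by_cases hr : r ∈ Ioc (0 : ℝ) 1
  · refine mul_le_mul_of_nonneg_right (hM _ ⟨?_, ?_⟩) (abs_nonneg _)
    · have := hr.1.le
      have : 0 ≤ r / ((n : ℝ) + 1) := by positivity
      linarith
    · have : r / ((n : ℝ) + 1) ≤ 1 := by
        rw [div_le_one (by positivity)]
        linarith [hr.2, Nat.cast_nonneg (α := ℝ) n]
      linarith
  · simp [stepKernel_eq_zero hr]

theorem tendsto_integral_mul_kernel {g : ℝ → ℝ} (hg : Continuous g) (a : ℝ) :
    Tendsto (fun n : ℕ => ∫ s, g s * (((n : ℝ) + 1) * stepKernel (((n : ℝ) + 1) * (s - a)))) atTop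
      (𝓝 (g a)) := by
  obtain ⟨M, hM⟩ := (isCompact_Icc (a := a) (b := a + 1)).exists_bound_of_continuousOn
    hg.continuousOn
  simp_rw [integral_mul_kernel]
  have : g a = ∫ r, g a * stepKernel r := by
    rw [integral_const_mul, integral_stepKernel, mul_one]
  rw [this]
  refine tendsto_integral_of_dominated_convergence (fun r => M * |stepKernel r|) (fun n => ?_)
    (integrable_stepKernel.abs.const_mul M) (fun n => Eventually.of_forall fun r => ?_)
    (Eventually.of_forall fun r => ?_)
  · have := continuous_stepKernel
    exact Continuous.aestronglyMeasurable (by fun_prop)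
  · rw [Real.norm_eq_abs, abs_mul]
    by_cases hr : r ∈ Ioc (0 : ℝ) 1
    · refine mul_le_mul_of_nonneg_right (hM _ ⟨?_, ?_⟩) (abs_nonneg _)
      · have := hr.1.le
        have : 0 ≤ r / ((n : ℝ) + 1) := by positivity
        linarith
      · have : r / ((n : ℝ) + 1) ≤ 1 := by
          rw [div_le_one (by positivity)]
          linarith [hr.2, Nat.cast_nonneg (α := ℝ) n]
        linarith
    · simp [stepKernel_eq_zero hr]
  · refine Tendsto.mul_const _ ?_
    refine (hg.tendsto a).comp ?_
    have : Tendsto (fun n : ℕ => a + r * (1 / ((n : ℝ) + 1))) atTop (𝓝 (a + r * 0)) :=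
      (tendsto_one_div_add_atTop_nhds_zero_nat.const_mul r).const_add a
    simpa [div_eq_mul_inv] using this

theorem integral_mul_deriv_cutoff (n : ℕ) {g : ℝ → ℝ} (hg : Continuous g) (a b : ℝ) :
    ∫ s, g s * deriv (cutoff n a b) s =
      (∫ s, g s * (((n : ℝ) + 1) * stepKernel (((n : ℝ) + 1) * (s - a)))) -
      ∫ s, g s * (((n : ℝ) + 1) * stepKernel (((n : ℝ) + 1) * (s - b))) := by
  rw [← integral_sub (integrable_mul_kernel n hg a) (integrable_mul_kernel n hg b)]
  simp only [deriv_cutoff, mul_sub]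

theorem tendsto_integral_cutoff_mul {h : ℕ → ℝ → ℝ} {h' : ℝ → ℝ} {a b M : ℝ} (hab : a ≤ b)
    (hm : ∀ n, AEStronglyMeasurable (h n)) (hM : ∀ n, ∀ s ∈ Icc a (b + 1), |h n s| ≤ M)
    (hlim : ∀ s, Tendsto (fun n => h n s) atTop (𝓝 (h' s))) :
    Tendsto (fun n => ∫ s, cutoff n a b s * h n s) atTop (𝓝 (∫ s in a..b, h' s)) := by
  rw [intervalIntegral.integral_of_le hab, ← integral_indicator measurableSet_Ioc]
  refine tendsto_integral_of_dominated_convergence ((Icc a (b + 1)).indicator fun _ => M)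
    (fun n => (contDiff_cutoff n a b).continuous.aestronglyMeasurable.mul (hm n)) ?_
    (fun n => Eventually.of_forall fun s => ?_) (Eventually.of_forall fun s => ?_)
  · exact (integrable_indicator_iff measurableSet_Icc).2 (by simp [integrableOn_const_iff])
  · by_cases hs : s ∈ Icc a (b + 1)
    · rw [indicator_of_mem hs, Real.norm_eq_abs, abs_mul, abs_of_nonneg (cutoff_nonneg n hab s)]
      calc _ ≤ 1 * |h n s| := by gcongr; exact cutoff_le_one n a b s
        _ ≤ M := by rw [one_mul]; exact hM n s hs
    · simp [cutoff_eq_zero n hab hs, hs]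
  · have := (tendsto_cutoff hab s).mul (hlim s)
    convert this using 2
    by_cases hs : s ∈ Ioc a b <;> simp [hs]

/-- In one variable the cutoff becomes an indicator, while in the other its derivative becomes the
difference of the Dirac masses at `c` and `d`. -/
theorem tendsto_integral_cutoff_mul_deriv_cutoff {G : ℝ → ℝ → ℝ}
    (hG : Continuous fun p : ℝ × ℝ => G p.1 p.2) {a b c d : ℝ} (hab : a ≤ b) (hcd : c ≤ d) :
    Tendsto (fun n => ∫ y, cutoff n a b y * ∫ s, G y s * deriv (cutoff n c d) s) atTop
      (𝓝 (∫ y in a..b, (G y c - G y d))) := by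
  obtain ⟨M, hM⟩ := ((isCompact_Icc (a := a) (b := b + 1)).prod
    (isCompact_Icc (a := c) (b := d + 1))).exists_bound_of_continuousOn hG.continuousOn
  have hGy : ∀ y, Continuous (G y) := fun y => hG.comp (by fun_prop : Continuous fun s => (y, s))
  refine tendsto_integral_cutoff_mul (M := M * (∫ r, |stepKernel r|) + M * ∫ r, |stepKernel r|)
    hab (fun n => ?_) (fun n y hy => ?_) (fun y => ?_)
  · have hc := continuous_deriv_cutoff n c d
    have : Continuous fun p : ℝ × ℝ => G p.1 p.2 * deriv (cutoff n c d) p.2 := by fun_prop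
    exact (this.stronglyMeasurable.integral_prod_right' (ν := volume)).aestronglyMeasurable
  · rw [integral_mul_deriv_cutoff n (hGy y)]
    refine (abs_sub _ _).trans (add_le_add ?_ ?_)
    · exact abs_integral_mul_kernel_le n fun s hs =>
        hM (y, s) ⟨hy, hs.1, by simpa using hs.2.trans (by linarith)⟩
    · exact abs_integral_mul_kernel_le n fun s hs =>
        hM (y, s) ⟨hy, hcd.trans hs.1, by simpa using hs.2.trans (by linarith)⟩
  · simp_rw [integral_mul_deriv_cutoff _ (hGy y)]
    exact (tendsto_integral_mul_kernel (hGy y) c).sub (tendsto_integral_mul_kernel (hGy y) d)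

/-! ### The weak equation integrated over rectangles. -/

/-- A continuous function `v` solving the Hunter-Saxton equation in the sense of distributions for
`t > 0`, where `f (x, t)` plays the role of the energy `∫_{-∞}^x w²` and is bounded by `C`. -/
structure IsEnergySolution (v f : ℝ → ℝ → ℝ) (C : ℝ) : Prop where
  continuous : Continuous fun p : ℝ × ℝ => v p.1 p.2
  measurable : Measurable fun p : ℝ × ℝ => f p.1 p.2
  nonneg : ∀ x t, 0 ≤ f x t
  le : ∀ x t, f x t ≤ C
  mono : ∀ t, Monotone fun x => f x t
  continuous_space : ∀ t, Continuous fun x => f x t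
  sq_sub_le : ∀ᵐ t, ∀ a b, a ≤ b → (v b t - v a t) ^ 2 ≤ (b - a) * (f b t - f a t)
  weak : ∀ φ : ℝ × ℝ → ℝ, ContDiff ℝ ∞ φ → HasCompactSupport φ → tsupport φ ⊆ {p | 0 < p.2} →
    ∫ p : ℝ × ℝ,
      (v p.1 p.2 * deriv (fun s => φ (p.1, s)) p.2
        + (1 / 2) * v p.1 p.2 ^ 2 * deriv (fun y => φ (y, p.2)) p.1
        + (1 / 2) * f p.1 p.2 * φ p) = 0

namespace IsEnergySolution

variable {v f : ℝ → ℝ → ℝ} {C : ℝ}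

theorem measurable_slice (hv : IsEnergySolution v f C) (t : ℝ) : Measurable fun y => f y t :=
  hv.measurable.comp (measurable_id.prodMk measurable_const)

theorem abs_le (hv : IsEnergySolution v f C) (x t : ℝ) : |f x t| ≤ C := by
  rw [abs_of_nonneg (hv.nonneg x t)]; exact hv.le x t

/-- The weak equation is tested with products of cutoffs. These lean to the right of their
intervals, so `0 < c` already makes them admissible. -/
theorem integral_rectangle (hv : IsEnergySolution v f C) {a b c d : ℝ} (hab : a ≤ b) (hc : 0 < c)
    (hcd : c ≤ d) :
    (∫ y in a..b, (v y c - v y d)) +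
      (∫ s in c..d, (1 / 2 * v a s ^ 2 - 1 / 2 * v b s ^ 2)) +
      ∫ s in c..d, ∫ y in a..b, 1 / 2 * f y s = 0 := by
  have hvc := hv.continuous
  have key : ∀ n : ℕ,
      (∫ y, cutoff n a b y * ∫ s, v y s * deriv (cutoff n c d) s) +
      (∫ s, cutoff n c d s * ∫ y, (1 / 2 * v y s ^ 2) * deriv (cutoff n a b) y) +
      (∫ s, cutoff n c d s * ∫ y, cutoff n a b y * (1 / 2 * f y s)) = 0 := by
    intro n
    have c1 := (contDiff_cutoff n a b).continuous
    have c2 := (contDiff_cutoff n c d).continuous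
    have c3 := continuous_deriv_cutoff n a b
    have c4 := continuous_deriv_cutoff n c d
    have hcpt : IsCompact (Icc a (b + 1) ×ˢ Icc c (d + 1)) := isCompact_Icc.prod isCompact_Icc
    have z1 : ∀ p ∉ Icc a (b + 1) ×ˢ Icc c (d + 1),
        cutoff n a b p.1 * cutoff n c d p.2 = 0 := by
      intro p hp
      by_cases h1 : p.1 ∈ Icc a (b + 1)
      · rw [cutoff_eq_zero n hcd (fun h2 => hp ⟨h1, h2⟩), mul_zero]
      · rw [cutoff_eq_zero n hab h1, zero_mul]
    have z2 : ∀ p ∉ Icc a (b + 1) ×ˢ Icc c (d + 1),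
        v p.1 p.2 * (cutoff n a b p.1 * deriv (cutoff n c d) p.2) = 0 := by
      intro p hp
      by_cases h1 : p.1 ∈ Icc a (b + 1)
      · rw [deriv_cutoff_eq_zero n hcd (fun h2 => hp ⟨h1, h2⟩), mul_zero, mul_zero]
      · rw [cutoff_eq_zero n hab h1, zero_mul, mul_zero]
    have z3 : ∀ p ∉ Icc a (b + 1) ×ˢ Icc c (d + 1),
        (1 / 2 * v p.1 p.2 ^ 2) * (deriv (cutoff n a b) p.1 * cutoff n c d p.2) = 0 := by
      intro p hp
      by_cases h1 : p.1 ∈ Icc a (b + 1)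
      · rw [cutoff_eq_zero n hcd (fun h2 => hp ⟨h1, h2⟩), mul_zero, mul_zero]
      · rw [deriv_cutoff_eq_zero n hab h1, zero_mul, mul_zero]
    have i1 : Integrable fun p : ℝ × ℝ =>
        v p.1 p.2 * (cutoff n a b p.1 * deriv (cutoff n c d) p.2) :=
      Continuous.integrable_of_hasCompactSupport (by fun_prop)
        (HasCompactSupport.intro hcpt z2)
    have i2 : Integrable fun p : ℝ × ℝ =>
        (1 / 2 * v p.1 p.2 ^ 2) * (deriv (cutoff n a b) p.1 * cutoff n c d p.2) :=
      Continuous.integrable_of_hasCompactSupport (by fun_prop)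
        (HasCompactSupport.intro hcpt z3)
    have i3 : Integrable fun p : ℝ × ℝ =>
        (1 / 2 * f p.1 p.2) * (cutoff n a b p.1 * cutoff n c d p.2) := by
      refine Integrable.bdd_mul (c := 1 / 2 * C) (Continuous.integrable_of_hasCompactSupport
        (by fun_prop) (HasCompactSupport.intro hcpt z1))
        (hv.measurable.const_mul _).aestronglyMeasurable (Eventually.of_forall fun p => ?_)
      rw [Real.norm_eq_abs, abs_mul, abs_of_pos (by norm_num : (0 : ℝ) < 1 / 2)]
      gcongr; exact hv.abs_le _ _
    have hw := hv.weak (fun p => cutoff n a b p.1 * cutoff n c d p.2)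
      (((contDiff_cutoff n a b).comp contDiff_fst).mul ((contDiff_cutoff n c d).comp contDiff_snd))
      (HasCompactSupport.intro hcpt z1)
      ((closure_minimal (fun p hp => by by_contra h; exact hp (z1 p h)) hcpt.isClosed).trans
        (fun p hp => hc.trans_le hp.2.1))
    have hd1 : ∀ p : ℝ × ℝ, deriv (fun s => cutoff n a b p.1 * cutoff n c d s) p.2 =
        cutoff n a b p.1 * deriv (cutoff n c d) p.2 := fun p => deriv_const_mul_field _
    have hd2 : ∀ p : ℝ × ℝ, deriv (fun y => cutoff n a b y * cutoff n c d p.2) p.1 =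
        deriv (cutoff n a b) p.1 * cutoff n c d p.2 := fun p => deriv_mul_const_field _
    simp only [hd1, hd2] at hw
    have i12 : Integrable fun p : ℝ × ℝ =>
        v p.1 p.2 * (cutoff n a b p.1 * deriv (cutoff n c d) p.2) +
          (1 / 2 * v p.1 p.2 ^ 2) * (deriv (cutoff n a b) p.1 * cutoff n c d p.2) := i1.add i2
    rw [integral_add i12 i3, integral_add i1 i2] at hw
    rw [Measure.volume_eq_prod] at hw i1 i2 i3
    rw [integral_prod _ i1, integral_prod_symm _ i2, integral_prod_symm _ i3] at hw
    rw [← hw]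
    congr 1
    · congr 1
      · congr 1; ext y
        rw [← integral_const_mul]; congr 1; ext s; ring
      · congr 1; ext s
        rw [← integral_const_mul]; congr 1; ext y; ring
    · congr 1; ext s
      rw [← integral_const_mul]; congr 1; ext y; ring
  have l1 := tendsto_integral_cutoff_mul_deriv_cutoff hvc hab hcd
  have l2 := tendsto_integral_cutoff_mul_deriv_cutoff (G := fun s y => 1 / 2 * v y s ^ 2)
    (by have := hvc.comp continuous_swap
        simp only [Function.comp_def, Prod.fst_swap, Prod.snd_swap] at this
        fun_prop) hcd hab
  have l3 : Tendsto (fun n => ∫ s, cutoff n c d s * ∫ y, cutoff n a b y * (1 / 2 * f y s)) atTop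
      (𝓝 (∫ s in c..d, ∫ y in a..b, 1 / 2 * f y s)) := by
    refine tendsto_integral_cutoff_mul (M := (1 / 2 * C) * (b + 1 - a)) hcd (fun n => ?_)
      (fun n s _ => ?_) (fun s => ?_)
    · have c1 := (contDiff_cutoff n a b).continuous
      have : Measurable fun p : ℝ × ℝ => cutoff n a b p.1 * (1 / 2 * f p.1 p.2) :=
        (c1.measurable.comp measurable_fst).mul (hv.measurable.const_mul _)
      exact this.stronglyMeasurable.integral_prod_left'.aestronglyMeasurable
    · rw [← setIntegral_eq_integral_of_forall_compl_eq_zero (s := Icc a (b + 1))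
        (fun y hy => by rw [cutoff_eq_zero n hab hy, zero_mul]), ← Real.norm_eq_abs]
      refine (norm_setIntegral_le_of_norm_le_const (C := 1 / 2 * C) (by simp) fun y _ => ?_).trans
        (le_of_eq ?_)
      · rw [Real.norm_eq_abs, abs_mul, abs_of_nonneg (cutoff_nonneg n hab y), abs_mul,
          abs_of_pos (by norm_num : (0 : ℝ) < 1 / 2)]
        calc _ ≤ 1 * (1 / 2 * C) := by
              gcongr
              · exact cutoff_le_one n a b y
              · exact hv.abs_le _ _
          _ = _ := one_mul _
      · rw [Real.volume_real_Icc_of_le (by linarith)]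
    · exact tendsto_integral_cutoff_mul (h := fun _ y => 1 / 2 * f y s) (M := 1 / 2 * C) hab
        (fun _ => ((hv.measurable_slice s).const_mul _).aestronglyMeasurable)
        (fun _ y _ => by
          rw [abs_mul, abs_of_pos (by norm_num : (0 : ℝ) < 1 / 2)]
          gcongr; exact hv.abs_le _ _) (fun y => tendsto_const_nhds)
  have := (l1.add l2).add l3
  simp only [key] at this
  exact (tendsto_nhds_unique tendsto_const_nhds this).symm

end IsEnergySolution

/-! ### Evolution of the solution along characteristics. -/

theorem intervalIntegrable_of_abs_le {g : ℝ → ℝ} {M : ℝ} (hg : Measurable g)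
    (hM : ∀ x, |g x| ≤ M) (a b : ℝ) : IntervalIntegrable g volume a b :=
  (intervalIntegrable_const (c := M)).mono_fun hg.aestronglyMeasurable
    (Eventually.of_forall fun x => (hM x).trans (le_abs_self M))

theorem tendsto_average_right {g : ℝ → ℝ} (hg : Continuous g) :
    Tendsto (fun n : ℕ => (1 / ((n : ℝ) + 1))⁻¹ * ∫ z in (0)..(1 / ((n : ℝ) + 1)), g z) atTop
      (𝓝 (g 0)) := by
  have h := (intervalIntegral.integral_hasDerivAt_right (hg.intervalIntegrable 0 0)
    hg.stronglyMeasurable.stronglyMeasurableAtFilter hg.continuousAt).tendsto_slope_zero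
  have h1 : Tendsto (fun n : ℕ => 1 / ((n : ℝ) + 1)) atTop (𝓝[≠] 0) := by
    refine tendsto_nhdsWithin_iff.2 ⟨tendsto_one_div_add_atTop_nhds_zero_nat,
      Eventually.of_forall fun n => ?_⟩
    have : 1 / ((n : ℝ) + 1) ≠ 0 := by positivity
    exact this
  have h2 := h.comp h1
  simp only [Function.comp_def, zero_add, intervalIntegral.integral_same, sub_zero,
    smul_eq_mul] at h2
  exact h2

namespace IsEnergySolution

variable {v f : ℝ → ℝ → ℝ} {C T : ℝ} {X : ℝ → ℝ}

theorem intervalIntegrable_slice (hv : IsEnergySolution v f C) (t a b : ℝ) :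
    IntervalIntegrable (fun y => f y t) volume a b :=
  intervalIntegrable_of_abs_le (hv.measurable_slice t) (fun y => hv.abs_le y t) a b

theorem measurable_along (hv : IsEnergySolution v f C) (hX : Continuous X) :
    Measurable fun s => f (X s) s :=
  hv.measurable.comp (hX.measurable.prodMk measurable_id)

theorem measurable_window (hv : IsEnergySolution v f C) (hX : Continuous X) {ε : ℝ} (hε : 0 ≤ ε) :
    Measurable fun s => ∫ z in (0)..ε, f (X s + z) s := by
  simp only [intervalIntegral.integral_of_le hε]
  have : Measurable fun p : ℝ × ℝ => f (X p.1 + p.2) p.1 :=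
    hv.measurable.comp (((hX.measurable.comp measurable_fst).add measurable_snd).prodMk
      measurable_fst)
  exact (this.stronglyMeasurable.integral_prod_right'
    (ν := volume.restrict (Ioc 0 ε))).measurable

theorem abs_window_le (hv : IsEnergySolution v f C) (x s : ℝ) {ε : ℝ} (hε : 0 ≤ ε) :
    |∫ z in (0)..ε, f (x + z) s| ≤ C * ε := by
  have := intervalIntegral.norm_integral_le_of_norm_le_const (a := 0) (b := ε) (C := C)
    (f := fun z => f (x + z) s) (fun z _ => hv.abs_le _ _)
  rwa [sub_zero, abs_of_nonneg hε] at this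

/-- Two windows of equal length differ by two intervals of length `|y - x|`. The bound is uniform in
`s`, which substitutes for the missing continuity of `f` in time. -/
theorem abs_window_sub_le (hv : IsEnergySolution v f C) (x y s ε : ℝ) :
    |(∫ z in (0)..ε, f (x + z) s) - ∫ z in (0)..ε, f (y + z) s| ≤ 2 * C * |y - x| := by
  have h1 : ∀ x, ∫ z in (0)..ε, f (x + z) s = ∫ z in x..(x + ε), f z s := by
    intro x
    rw [intervalIntegral.integral_comp_add_left (fun z => f z s) x, add_zero]
  rw [h1, h1, intervalIntegral.integral_interval_sub_interval_comm
    (hv.intervalIntegrable_slice s _ _) (hv.intervalIntegrable_slice s _ _)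
    (hv.intervalIntegrable_slice s _ _)]
  have h2 : ∀ a b, |∫ z in a..b, f z s| ≤ C * |b - a| := fun a b =>
    intervalIntegral.norm_integral_le_of_norm_le_const (f := fun z => f z s)
      (fun z _ => hv.abs_le z s)
  refine (abs_sub _ _).trans ?_
  have h3 := h2 x y
  have h4 := h2 (x + ε) (y + ε)
  rw [add_sub_add_right_eq_sub] at h4
  linarith

/-- The rate of change of the integral of `v` over the window `[X s, X s + ε]`. -/
noncomputable def windowRate (v f : ℝ → ℝ → ℝ) (X : ℝ → ℝ) (ε s : ℝ) : ℝ :=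
  -(1 / 2 * (v (X s + ε) s - v (X s) s) ^ 2) + 1 / 2 * ∫ z in (0)..ε, f (X s + z) s

theorem intervalIntegrable_windowRate (hv : IsEnergySolution v f C) (hX : Continuous X) {ε : ℝ}
    (hε : 0 ≤ ε) (a b : ℝ) : IntervalIntegrable (windowRate v f X ε) volume a b := by
  have hvc := hv.continuous
  have c1 : Continuous fun s => v (X s) s := hvc.comp (hX.prodMk continuous_id)
  have c2 : Continuous fun s => v (X s + ε) s :=
    hvc.comp ((hX.add continuous_const).prodMk continuous_id)
  refine IntervalIntegrable.add (Continuous.intervalIntegrable (by fun_prop) _ _) ?_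
  exact (intervalIntegrable_of_abs_le (hv.measurable_window hX hε)
    (fun s => hv.abs_window_le _ s hε) a b).const_mul _

/-- The window stays at `X a` while time runs from `a` to `b`, which is the rectangle identity, and
is then moved to `X b` at the frozen time `b`. The substitution `y = X s` writes the second step as
a time integral. -/
theorem window_increment (hv : IsEnergySolution v f C) (hX : IsCurve v T X) {ε a b : ℝ}
    (hε : 0 ≤ ε) (ha : 0 < a) (hab : a ≤ b) (hb : b ≤ T) :
    (∫ z in (0)..ε, v (X b + z) b) - (∫ z in (0)..ε, v (X a + z) a) =
      ∫ s in a..b, ((v (X s + ε) b - v (X s) b) * v (X s) s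
        + (1 / 2 * v (X a) s ^ 2 - 1 / 2 * v (X a + ε) s ^ 2)
        + 1 / 2 * ∫ z in (0)..ε, f (X a + z) s) := by
  have hvc := hv.continuous
  have hXc := hX.continuous
  have cv : ∀ {α β : ℝ → ℝ}, Continuous α → Continuous β → Continuous fun s => v (α s) (β s) :=
    fun hα hβ => hvc.comp (hα.prodMk hβ)
  have hvi : ∀ t x y, IntervalIntegrable (fun z => v z t) volume x y := fun t x y =>
    (cv continuous_id continuous_const).intervalIntegrable x y
  have hshift : ∀ x t, ∫ z in (0)..ε, v (x + z) t = ∫ z in x..(x + ε), v z t := by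
    intro x t
    rw [intervalIntegral.integral_comp_add_left (fun z => v z t) x, add_zero]
  have hshift' : ∀ s, ∫ z in (0)..ε, f (X a + z) s = ∫ z in (X a)..(X a + ε), f z s := by
    intro s
    rw [intervalIntegral.integral_comp_add_left (fun z => f z s) (X a), add_zero]
  have hrect := hv.integral_rectangle (show X a ≤ X a + ε by linarith) ha hab
  rw [intervalIntegral.integral_sub (hvi _ _ _) (hvi _ _ _)] at hrect
  have hsub : ∫ s in a..b, (v (X s + ε) b - v (X s) b) * v (X s) s =
      ∫ y in (X a)..(X b), (v (y + ε) b - v y b) := by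
    refine intervalIntegral.integral_comp_mul_deriv'' (f := X) (f' := fun s => v (X s) s)
      (g := fun y => v (y + ε) b - v y b) hXc.continuousOn (fun s hs => ?_)
      (cv hXc continuous_id).continuousOn
      ((cv (continuous_id.add continuous_const) continuous_const).sub
        (cv continuous_id continuous_const)).continuousOn
    rw [min_eq_left hab, max_eq_right hab] at hs
    exact (hX.hasDerivWithinAt_Ici hvc ⟨ha.le.trans hs.1.le, hs.2.trans_le hb⟩).mono
      Ioi_subset_Ici_self
  have hsplit : ∫ y in (X a)..(X b), (v (y + ε) b - v y b) =
      (∫ z in (X b)..(X b + ε), v z b) - ∫ z in (X a)..(X a + ε), v z b := by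
    have i0 : IntervalIntegrable (fun y => v (y + ε) b) volume (X a) (X b) :=
      (cv (continuous_id.add continuous_const) continuous_const).intervalIntegrable _ _
    rw [intervalIntegral.integral_sub i0 (hvi _ _ _), intervalIntegral.integral_comp_add_right (fun y => v y b) ε,
      intervalIntegral.integral_interval_sub_interval_comm (hvi _ _ _) (hvi _ _ _) (hvi _ _ _),
      intervalIntegral.integral_symm (X a) (X a + ε),
      intervalIntegral.integral_symm (X b) (X b + ε)]
    ring
  have i1 : IntervalIntegrable (fun s => (v (X s + ε) b - v (X s) b) * v (X s) s) volume a b :=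
    (((cv (hXc.add continuous_const) continuous_const).sub
        (cv hXc continuous_const)).mul (cv hXc continuous_id)).intervalIntegrable _ _
  have i2 : IntervalIntegrable (fun s => 1 / 2 * v (X a) s ^ 2 - 1 / 2 * v (X a + ε) s ^ 2)
      volume a b :=
    ((((cv continuous_const continuous_id).pow 2).const_mul _).sub
      (((cv continuous_const continuous_id).pow 2).const_mul _)).intervalIntegrable _ _
  have i3 : IntervalIntegrable (fun s => 1 / 2 * ∫ z in (0)..ε, f (X a + z) s) volume a b :=
    (intervalIntegrable_of_abs_le (hv.measurable_window continuous_const hε)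
      (fun s => hv.abs_window_le _ s hε) a b).const_mul _
  have i12 : IntervalIntegrable (fun s => (v (X s + ε) b - v (X s) b) * v (X s) s
        + (1 / 2 * v (X a) s ^ 2 - 1 / 2 * v (X a + ε) s ^ 2)) volume a b := i1.add i2
  rw [intervalIntegral.integral_add i12 i3, intervalIntegral.integral_add i1 i2, hsub, hsplit,
    hshift, hshift]
  simp only [hshift']
  simp only [intervalIntegral.integral_const_mul] at hrect ⊢
  linarith

/-- The rate is only measurable in time, so the window integral is not differentiated itself.
Subtracting the primitive of the rate leaves a function whose right derivative vanishes everywhere.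
-/
theorem window_sub_eq (hv : IsEnergySolution v f C) (hX : IsCurve v T X) {ε a b : ℝ}
    (hε : 0 ≤ ε) (ha : 0 < a) (hab : a ≤ b) (hb : b ≤ T) :
    (∫ z in (0)..ε, v (X b + z) b) - (∫ z in (0)..ε, v (X a + z) a) =
      ∫ s in a..b, windowRate v f X ε s := by
  have hvc := hv.continuous
  have hXc := hX.continuous
  have cv : ∀ {α β : ℝ → ℝ}, Continuous α → Continuous β → Continuous fun s => v (α s) (β s) :=
    fun hα hβ => hvc.comp (hα.prodMk hβ)
  set W : ℝ → ℝ := fun s => ∫ z in (0)..ε, v (X s + z) s with hW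
  have hWc : Continuous W :=
    intervalIntegral.continuous_parametric_intervalIntegral_of_continuous'
      (f := fun s z => v (X s + z) s) (hvc.comp (f := fun p : ℝ × ℝ => (X p.1 + p.2, p.1)) (by fun_prop)) 0 ε
  have hRi := hv.intervalIntegrable_windowRate hXc hε
  have hPc : Continuous fun s => ∫ r in a..s, windowRate v f X ε r :=
    intervalIntegral.continuous_primitive hRi a
  have key := constant_of_has_deriv_right_zero
    (f := fun s => W s - ∫ r in a..s, windowRate v f X ε r) (a := a) (b := b)
    (hWc.sub hPc).continuousOn ?_ b (right_mem_Icc.2 hab)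
  · simp only [intervalIntegral.integral_same, sub_zero] at key
    linarith
  intro s₁ hs₁
  rw [hasDerivWithinAt_iff_isLittleO, Asymptotics.isLittleO_iff]
  intro e he
  have cv2 : ∀ {α β : ℝ × ℝ → ℝ}, Continuous α → Continuous β →
      Continuous fun p => v (α p) (β p) := fun hα hβ => hvc.comp (hα.prodMk hβ)
  have hvX : ∀ {α β : ℝ × ℝ → ℝ}, Continuous α → Continuous β →
      Continuous fun p => v (X (α p) + ε) (β p) := fun hα hβ =>
    cv2 ((hXc.comp hα).add continuous_const) hβ
  have hvX' : ∀ {α β : ℝ × ℝ → ℝ}, Continuous α → Continuous β →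
      Continuous fun p => v (X (α p)) (β p) := fun hα hβ => cv2 (hXc.comp hα) hβ
  -- The continuous part of the error made by freezing time at `p.1` and the window at `X s₁`. It
  -- vanishes at `(s₁, s₁)` because `-(A - B)² / 2 = (A - B) * B + B² / 2 - A² / 2`.
  set Q₀ : ℝ × ℝ → ℝ := fun p =>
    ((v (X p.2 + ε) p.1 - v (X p.2) p.1) - (v (X p.2 + ε) p.2 - v (X p.2) p.2)) * v (X p.2) p.2
      + (1 / 2 * v (X s₁) p.2 ^ 2 - 1 / 2 * v (X p.2) p.2 ^ 2)
      - (1 / 2 * v (X s₁ + ε) p.2 ^ 2 - 1 / 2 * v (X p.2 + ε) p.2 ^ 2) with hQ₀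
  have hQ₀c : Continuous Q₀ := by
    have c1 := hvX (α := Prod.snd) (β := Prod.fst) continuous_snd continuous_fst
    have c2 := hvX' (α := Prod.snd) (β := Prod.fst) continuous_snd continuous_fst
    have c3 := hvX (α := Prod.snd) (β := Prod.snd) continuous_snd continuous_snd
    have c4 := hvX' (α := Prod.snd) (β := Prod.snd) continuous_snd continuous_snd
    have c5 := hvX (α := fun _ => s₁) (β := Prod.snd) continuous_const continuous_snd
    have c6 := hvX' (α := fun _ => s₁) (β := Prod.snd) continuous_const continuous_snd
    exact (((((c1.sub c2).sub (c3.sub c4)).mul c4).add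
      (((c6.pow 2).const_mul _).sub ((c4.pow 2).const_mul _))).sub
      (((c5.pow 2).const_mul _).sub ((c3.pow 2).const_mul _)))
  have hQc : Continuous fun p : ℝ × ℝ => |Q₀ p| + C * |X p.2 - X s₁| := by fun_prop
  obtain ⟨ρ, hρ, hρQ⟩ := Metric.continuousAt_iff.1 (hQc.continuousAt (x := (s₁, s₁))) e he
  have hmin : s₁ < min b (s₁ + ρ) := lt_min hs₁.2 (by linarith)
  filter_upwards [Ico_mem_nhdsGE hmin] with s₂ hs₂
  have h12 : s₁ ≤ s₂ := hs₂.1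
  have hs₂b : s₂ ≤ b := (hs₂.2.trans_le (min_le_left _ _)).le
  have hs₂ρ : s₂ < s₁ + ρ := hs₂.2.trans_le (min_le_right _ _)
  have hinc := hv.window_increment hX hε (ha.trans_le hs₁.1) h12 (hs₂b.trans hb)
  have hadd : (∫ r in a..s₂, windowRate v f X ε r) - ∫ r in a..s₁, windowRate v f X ε r =
      ∫ r in s₁..s₂, windowRate v f X ε r :=
    intervalIntegral.integral_interval_sub_left (hRi _ _) (hRi _ _)
  have hfi : ∀ {Y : ℝ → ℝ}, Continuous Y →
      IntervalIntegrable (fun s => ∫ z in (0)..ε, f (Y s + z) s) volume s₁ s₂ := fun hY =>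
    intervalIntegrable_of_abs_le (hv.measurable_window hY hε)
      (fun s => hv.abs_window_le _ s hε) _ _
  have hdiff : (W s₂ - ∫ r in a..s₂, windowRate v f X ε r) -
      (W s₁ - ∫ r in a..s₁, windowRate v f X ε r) =
      ∫ s in s₁..s₂, (Q₀ (s₂, s) + 1 / 2 * ((∫ z in (0)..ε, f (X s₁ + z) s) -
        ∫ z in (0)..ε, f (X s + z) s)) := by
    have e1 : (W s₂ - ∫ r in a..s₂, windowRate v f X ε r) -
        (W s₁ - ∫ r in a..s₁, windowRate v f X ε r) =
        (W s₂ - W s₁) - ∫ r in s₁..s₂, windowRate v f X ε r := by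
      rw [← hadd]; ring
    rw [e1, hinc, ← intervalIntegral.integral_sub ?_ (hRi _ _)]
    · refine intervalIntegral.integral_congr fun s _ => ?_
      simp only [hQ₀, windowRate]; ring
    · refine IntervalIntegrable.add (Continuous.intervalIntegrable ?_ _ _)
        ((hfi continuous_const).const_mul _)
      exact (((cv (hXc.add continuous_const) continuous_const).sub
        (cv hXc continuous_const)).mul (cv hXc continuous_id)).add
        ((((cv continuous_const continuous_id).pow 2).const_mul _).sub
        (((cv continuous_const continuous_id).pow 2).const_mul _))
  rw [hdiff, smul_zero, sub_zero, Real.norm_eq_abs (s₂ - s₁)]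
  refine intervalIntegral.norm_integral_le_of_norm_le_const fun s hs => ?_
  rw [uIoc_of_le h12] at hs
  have hd := hρQ (x := (s₂, s)) (by
    rw [Prod.dist_eq, max_lt_iff, Real.dist_eq, Real.dist_eq, abs_of_nonneg, abs_of_nonneg]
    · constructor <;> simp only <;> linarith [hs.2]
    · simp only; linarith [hs.1]
    · simp only; linarith)
  have hQ0 : Q₀ (s₁, s₁) = 0 := by simp only [hQ₀]; ring
  rw [hQ0, Real.dist_eq] at hd
  simp only [abs_zero, sub_self, mul_zero, add_zero, sub_zero] at hd
  rw [Real.norm_eq_abs]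
  refine (abs_add_le _ _).trans ((add_le_add_right ?_ _).trans ((le_abs_self _).trans hd.le))
  rw [abs_mul, abs_of_pos (by norm_num : (0 : ℝ) < 1 / 2)]
  have := hv.abs_window_sub_le (X s₁) (X s) s ε
  linarith

/-- The window identity is divided by its width, which then tends to zero. The quadratic term
divided by the width is controlled by the energy in the window; this is bounded by `C` and vanishes
in the limit since `f` is continuous in space. -/
theorem sub_eq_integral_of_pos (hv : IsEnergySolution v f C) (hX : IsCurve v T X) {a b : ℝ}
    (ha : 0 < a) (hab : a ≤ b) (hb : b ≤ T) :
    v (X b) b - v (X a) a = ∫ s in a..b, 1 / 2 * f (X s) s := by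
  have hvc := hv.continuous
  have hXc := hX.continuous
  have havg : ∀ s, Tendsto (fun n : ℕ => (1 / ((n : ℝ) + 1))⁻¹ *
      ∫ z in (0)..(1 / ((n : ℝ) + 1)), v (X s + z) s) atTop (𝓝 (v (X s) s)) := fun s => by
    have := tendsto_average_right (g := fun z => v (X s + z) s)
      (hvc.comp (f := fun z => (X s + z, s)) (by fun_prop))
    simpa only [add_zero] using this
  refine tendsto_nhds_unique ((havg b).sub (havg a)) ?_
  have hR : ∀ n : ℕ, (1 / ((n : ℝ) + 1))⁻¹ * (∫ z in (0)..(1 / ((n : ℝ) + 1)), v (X b + z) b) -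
      (1 / ((n : ℝ) + 1))⁻¹ * (∫ z in (0)..(1 / ((n : ℝ) + 1)), v (X a + z) a) =
      ∫ s in a..b, (1 / ((n : ℝ) + 1))⁻¹ * windowRate v f X (1 / ((n : ℝ) + 1)) s := by
    intro n
    rw [← mul_sub, hv.window_sub_eq hX (by positivity) ha hab hb,
      intervalIntegral.integral_const_mul]
  simp only [hR]
  have hbound : ∀ᵐ s, ∀ n : ℕ, (1 / ((n : ℝ) + 1))⁻¹ *
      (v (X s + 1 / ((n : ℝ) + 1)) s - v (X s) s) ^ 2 ≤
        f (X s + 1 / ((n : ℝ) + 1)) s - f (X s) s := by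
    filter_upwards [hv.sq_sub_le] with s hs n
    have hn : 0 < 1 / ((n : ℝ) + 1) := by positivity
    rw [inv_mul_le_iff₀ hn]
    have := hs (X s) (X s + 1 / ((n : ℝ) + 1)) (by linarith)
    rwa [add_sub_cancel_left] at this
  refine intervalIntegral.tendsto_integral_filter_of_dominated_convergence (fun _ => C)
    (Eventually.of_forall fun n => ?_) (Eventually.of_forall fun n => ?_)
    intervalIntegrable_const ?_
  · exact (intervalIntegrable_iff.1 ((hv.intervalIntegrable_windowRate hXc (by positivity)
      a b).const_mul _)).aestronglyMeasurable
  · filter_upwards [hbound] with s hs _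
    have hn : 0 < 1 / ((n : ℝ) + 1) := by positivity
    have h1 := hs n
    have h2 := hv.abs_window_le (X s) s hn.le
    have h3 : (0 : ℝ) ≤ (1 / ((n : ℝ) + 1))⁻¹ *
        (v (X s + 1 / ((n : ℝ) + 1)) s - v (X s) s) ^ 2 := by positivity
    have h4 : |(1 / ((n : ℝ) + 1))⁻¹ * ∫ z in (0)..(1 / ((n : ℝ) + 1)), f (X s + z) s| ≤ C := by
      rw [abs_mul, abs_of_pos (inv_pos.2 hn), inv_mul_le_iff₀ hn]; linarith
    have h5 := hv.nonneg (X s) s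
    have h6 := hv.le (X s + 1 / ((n : ℝ) + 1)) s
    rw [Real.norm_eq_abs, windowRate, _root_.abs_le]
    rw [_root_.abs_le] at h4
    constructor <;> nlinarith
  · filter_upwards [hbound] with s hs _
    have hfc := hv.continuous_space s
    have h1 : Tendsto (fun n : ℕ => f (X s + 1 / ((n : ℝ) + 1)) s - f (X s) s) atTop (𝓝 0) := by
      have h := ((hfc.tendsto (X s + 0)).comp
        (tendsto_one_div_add_atTop_nhds_zero_nat.const_add (X s))).sub_const (f (X s) s)
      simpa using h
    have h2 := squeeze_zero (fun n => by positivity) hs h1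
    have h3 := tendsto_average_right (g := fun z => f (X s + z) s)
      (hfc.comp (f := fun z => X s + z) (by fun_prop))
    have h4 := (h2.const_mul (-(1 / 2))).add (h3.const_mul (1 / 2))
    simp only [mul_zero, zero_add, add_zero] at h4
    refine h4.congr fun n => ?_
    rw [windowRate]; ring

/-- Along characteristics a weak solution changes at the rate given by half of the energy to the
left of the characteristic. -/
theorem sub_eq_integral (hv : IsEnergySolution v f C) (hX : IsCurve v T X) {a b : ℝ}
    (ha : 0 ≤ a) (hab : a ≤ b) (hb : b ≤ T) :
    v (X b) b - v (X a) a = ∫ s in a..b, 1 / 2 * f (X s) s := by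
  rcases hab.eq_or_lt with rfl | hlt
  · simp
  have hi : ∀ c d, IntervalIntegrable (fun s => 1 / 2 * f (X s) s) volume c d := fun c d =>
    (intervalIntegrable_of_abs_le (hv.measurable_along hX.continuous)
      (fun s => hv.abs_le _ s) c d).const_mul _
  have hc1 : Continuous fun r => v (X b) b - v (X r) r :=
    continuous_const.sub (hv.continuous.comp (hX.continuous.prodMk continuous_id))
  have hc2 : Continuous fun r => ∫ s in r..b, 1 / 2 * f (X s) s := by
    have := intervalIntegral.continuous_primitive hi b
    simp_rw [intervalIntegral.integral_symm b]
    exact this.neg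
  -- Starting times `r > a` are covered already; letting `r` decrease to `a` admits `a = 0`, where
  -- the weak equation gives no direct information.
  refine tendsto_nhds_unique ((hc1.tendsto a).mono_left (nhdsWithin_le_nhds (s := Ioi a)))
    (((hc2.tendsto a).mono_left (nhdsWithin_le_nhds (s := Ioi a))).congr' ?_)
  filter_upwards [Ioo_mem_nhdsGT hlt] with r hr
  exact (hv.sub_eq_integral_of_pos hX (ha.trans_lt hr.1) hr.2.le hb).symm

/-- Subtracting the evolution laws of the two curves leaves half the energy between them, which
`sq_sub_le` bounds from below at almost every time. -/
theorem riccati (hv : IsEnergySolution v f C) {X₁ X₂ : ℝ → ℝ} (h₁ : IsCurve v T X₁)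
    (h₂ : IsCurve v T X₂) {a b : ℝ} (ha : 0 ≤ a) (hab : a ≤ b) (hb : b ≤ T)
    (hpos : ∀ s ∈ Icc a b, 0 < X₂ s - X₁ s) :
    1 / 2 * ∫ s in a..b, (v (X₂ s) s - v (X₁ s) s) ^ 2 / (X₂ s - X₁ s) ≤
      (v (X₂ b) b - v (X₁ b) b) - (v (X₂ a) a - v (X₁ a) a) := by
  have hi : ∀ {Y : ℝ → ℝ}, Continuous Y →
      IntervalIntegrable (fun s => 1 / 2 * f (Y s) s) volume a b := fun hY =>
    (intervalIntegrable_of_abs_le (hv.measurable_along hY) (fun s => hv.abs_le _ s) a b).const_mul _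
  have e : (v (X₂ b) b - v (X₁ b) b) - (v (X₂ a) a - v (X₁ a) a) =
      ∫ s in a..b, (1 / 2 * f (X₂ s) s - 1 / 2 * f (X₁ s) s) := by
    rw [intervalIntegral.integral_sub (hi h₂.continuous) (hi h₁.continuous),
      ← hv.sub_eq_integral h₁ ha hab hb, ← hv.sub_eq_integral h₂ ha hab hb]
    ring
  rw [e, ← intervalIntegral.integral_const_mul]
  have hc : ∀ {Y : ℝ → ℝ}, Continuous Y → Continuous fun s => v (Y s) s := fun hY =>
    hv.continuous.comp (hY.prodMk continuous_id)
  refine intervalIntegral.integral_mono_ae_restrict hab ?_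
    ((hi h₂.continuous).sub (hi h₁.continuous)) ?_
  · refine ContinuousOn.intervalIntegrable ?_
    rw [uIcc_of_le hab]
    exact continuousOn_const.mul ((((hc h₂.continuous).sub (hc h₁.continuous)).pow 2).continuousOn.div
      (h₂.continuous.sub h₁.continuous).continuousOn fun s hs => (hpos s hs).ne')
  · filter_upwards [ae_restrict_of_ae hv.sq_sub_le, ae_restrict_mem measurableSet_Icc] with s hs hsab
    have hp := hpos s hsab
    have := hs (X₁ s) (X₂ s) (by linarith)
    rw [← mul_sub]
    gcongr
    rw [div_le_iff₀ hp]; linarith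

end IsEnergySolution

/-! ### Weak solutions as energy solutions, and their growth in space. -/

theorem integral_sq_le_of_eLpNorm_le {g : ℝ → ℝ} (hg : MemLp g 2 volume) {C : ℝ≥0}
    (h : eLpNorm g 2 volume ≤ C) : ∫ y, g y ^ 2 ≤ (C : ℝ) ^ 2 := by
  have h1 := eLpNorm_nnreal_pow_eq_lintegral (f := g) (μ := volume) (p := 2) two_ne_zero
  have h2 : ENNReal.ofReal (∫ y, g y ^ 2) = eLpNorm g 2 volume ^ 2 := by
    rw [ofReal_integral_eq_lintegral_ofReal hg.integrable_sq
      (Eventually.of_forall fun y => sq_nonneg _)]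
    have h3 : eLpNorm g 2 volume ^ 2 = eLpNorm g ((2 : ℝ≥0) : ℝ≥0∞) volume ^ ((2 : ℝ≥0) : ℝ) := by
      rw [← ENNReal.rpow_natCast]; norm_num
    rw [h3, h1]
    refine lintegral_congr fun y => ?_
    rw [← ofReal_norm, ENNReal.ofReal_rpow_of_nonneg (norm_nonneg _) (by norm_num)]
    congr 1
    simp
  have h4 : ENNReal.ofReal (∫ y, g y ^ 2) ≤ ENNReal.ofReal ((C : ℝ) ^ 2) := by
    rw [h2, ENNReal.ofReal_pow (NNReal.coe_nonneg C), ENNReal.ofReal_coe_nnreal]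
    gcongr
  exact (ENNReal.ofReal_le_ofReal_iff (by positivity)).1 h4

/-- Cauchy–Schwarz in variance form: the square of the deviation of `deriv g` from its mean `m` has
nonnegative integral. -/
theorem sq_sub_le_integral_deriv_sq {g : ℝ → ℝ} {a b : ℝ} (hab : a ≤ b)
    (hg : AbsolutelyContinuousOnInterval g a b) (hi : Integrable fun y => deriv g y ^ 2) :
    (g b - g a) ^ 2 ≤ (b - a) * ∫ y in a..b, deriv g y ^ 2 := by
  rcases hab.eq_or_lt with rfl | hlt
  · simp
  have hd := hg.intervalIntegrable_deriv
  have hd2 : IntervalIntegrable (fun y => deriv g y ^ 2) volume a b := hi.intervalIntegrable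
  set m := (g b - g a) / (b - a) with hm
  have hba : 0 < b - a := sub_pos.2 hlt
  have h0 : 0 ≤ ∫ y in a..b, (deriv g y - m) ^ 2 :=
    intervalIntegral.integral_nonneg hab fun y _ => sq_nonneg _
  have h1 : ∫ y in a..b, (deriv g y - m) ^ 2 =
      (∫ y in a..b, deriv g y ^ 2) - 2 * m * (g b - g a) + (b - a) * m ^ 2 := by
    have e : ∀ y, (deriv g y - m) ^ 2 = (deriv g y ^ 2 - 2 * m * deriv g y) + m ^ 2 := by
      intro y; ring
    have hs : IntervalIntegrable (fun y => deriv g y ^ 2 - 2 * m * deriv g y) volume a b :=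
      hd2.sub (hd.const_mul _)
    simp only [e]
    rw [intervalIntegral.integral_add hs intervalIntegrable_const,
      intervalIntegral.integral_sub hd2 (hd.const_mul _), intervalIntegral.integral_const_mul,
      hg.integral_deriv_eq_sub, intervalIntegral.integral_const, smul_eq_mul]
  have h2 : m * (b - a) = g b - g a := by rw [hm]; field_simp
  rw [h1] at h0
  have h3 := mul_nonneg hba.le h0
  rw [← h2] at h3 ⊢
  nlinarith

/-- The energy `∫_{-∞}^x w²` at the times where the total energy is at most `C`, and `0` at other
times. -/
noncomputable def truncatedEnergy (v : ℝ → ℝ → ℝ) (C x t : ℝ) : ℝ :=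
  open Classical in if ∫ y, wx v y t ^ 2 ≤ C then ∫ y in Iic x, wx v y t ^ 2 else 0

theorem measurable_wx {v : ℝ → ℝ → ℝ} (hv : Continuous fun p : ℝ × ℝ => v p.1 p.2) :
    Measurable fun p : ℝ × ℝ => wx v p.2 p.1 :=
  measurable_deriv_with_param (f := fun t y => v y t) (hv.comp continuous_swap)

theorem measurable_truncatedEnergy {v : ℝ → ℝ → ℝ} (hv : Continuous fun p : ℝ × ℝ => v p.1 p.2)
    (C : ℝ) : Measurable fun p : ℝ × ℝ => truncatedEnergy v C p.1 p.2 := by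
  have hw := measurable_wx hv
  have h1 : Measurable fun t => ∫ y, wx v y t ^ 2 :=
    ((hw.pow_const 2).stronglyMeasurable.integral_prod_right' (ν := volume)).measurable
  have h2 : Measurable fun p : ℝ × ℝ => ∫ y in Iic p.1, wx v y p.2 ^ 2 := by
    have e : ∀ p : ℝ × ℝ, ∫ y in Iic p.1, wx v y p.2 ^ 2 =
        ∫ y, {q : (ℝ × ℝ) × ℝ | q.2 ≤ q.1.1}.indicator (fun q => wx v q.2 q.1.2 ^ 2) (p, y) := by
      intro p
      rw [← integral_indicator measurableSet_Iic]
      rfl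
    simp only [e]
    have hm : Measurable fun q : (ℝ × ℝ) × ℝ => wx v q.2 q.1.2 ^ 2 :=
      (hw.comp ((measurable_snd.comp measurable_fst).prodMk measurable_snd)).pow_const 2
    exact ((hm.indicator (measurableSet_le measurable_snd
      (measurable_fst.comp measurable_fst))).stronglyMeasurable.integral_prod_right'
        (ν := volume)).measurable
  classical
  exact Measurable.ite (measurableSet_le (h1.comp measurable_snd) measurable_const) h2
    measurable_const

theorem IsWeakSolution.exists_isEnergySolution {u : ℝ → ℝ → ℝ} {u₀ w₀ : ℝ → ℝ}
    (hu : IsWeakSolution u u₀ w₀) :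
    ∃ (f : ℝ → ℝ → ℝ) (C : ℝ), IsEnergySolution (fun x t => u x (max t 0)) f C := by
  set v : ℝ → ℝ → ℝ := fun x t => u x (max t 0) with hv
  have hvc : Continuous fun p : ℝ × ℝ => v p.1 p.2 :=
    hu.continuousOn.comp_continuous (f := fun p : ℝ × ℝ => (p.1, max p.2 0)) (by fun_prop)
      (fun p => le_max_right p.2 0)
  have hwx : ∀ y t, wx v y t = wx u y (max t 0) := fun y t => rfl
  have hint : ∀ t, Integrable fun y => wx v y t ^ 2 := fun t =>
    (hu.memLp_wx (max t 0) (le_max_right _ _)).integrable_sq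
  obtain ⟨C₀, hC₀⟩ := hu.essBounded_wx
  -- The second entry covers negative times, where the extension is frozen at its value at time `0`.
  set C : ℝ := max ((C₀ : ℝ) ^ 2) (∫ y, wx u y 0 ^ 2) with hC
  have hCt : ∀ᵐ t, ∫ y, wx v y t ^ 2 ≤ C := by
    rw [ae_restrict_iff' measurableSet_Ici] at hC₀
    filter_upwards [hC₀] with t ht
    rcases le_total 0 t with h | h
    · simp only [hwx, max_eq_left h]
      exact (integral_sq_le_of_eLpNorm_le (hu.memLp_wx t h) (ht h)).trans (le_max_left _ _)
    · simp only [hwx, max_eq_right h]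
      exact le_max_right _ _
  have hC0 : 0 ≤ C := (sq_nonneg (C₀ : ℝ)).trans (le_max_left _ _)
  refine ⟨truncatedEnergy v C, C, hvc, measurable_truncatedEnergy hvc C, ?_, ?_, ?_, ?_, ?_, ?_⟩
  · intro x t
    unfold truncatedEnergy
    split_ifs
    · exact integral_nonneg fun y => sq_nonneg _
    · exact le_rfl
  · intro x t
    unfold truncatedEnergy
    split_ifs with h
    · exact (setIntegral_le_integral (hint t) (Eventually.of_forall fun y => sq_nonneg _)).trans h
    · exact hC0
  · intro t x y hxy
    simp only [truncatedEnergy]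
    split_ifs with h
    · exact setIntegral_mono_set (hint t).integrableOn (Eventually.of_forall fun y => sq_nonneg _)
        (Iic_subset_Iic.2 hxy).eventuallyLE
    · exact le_rfl
  · intro t
    simp only [truncatedEnergy]
    split_ifs with h
    · have e : ∀ x, ∫ y in Iic x, wx v y t ^ 2 =
          (∫ y in Iic 0, wx v y t ^ 2) + ∫ y in (0)..x, wx v y t ^ 2 := by
        intro x
        rw [← intervalIntegral.integral_Iic_sub_Iic (hint t).integrableOn (hint t).integrableOn]
        ring
      exact (continuous_const.add (intervalIntegral.continuous_primitive
        (fun a b => (hint t).intervalIntegrable) 0)).congr fun x => (e x).symm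
    · exact continuous_const
  · filter_upwards [hCt] with t ht a b hab
    simp only [truncatedEnergy, if_pos ht]
    rw [intervalIntegral.integral_Iic_sub_Iic (hint t).integrableOn (hint t).integrableOn]
    exact sq_sub_le_integral_deriv_sq hab
      (hu.absolutelyContinuous_space (max t 0) (le_max_right _ _) a b) (hint t)
  · intro φ h1 h2 h3
    rw [← hu.equation φ h1 h2 h3]
    have hCp : ∀ᵐ p : ℝ × ℝ, ∫ y, wx v y p.2 ^ 2 ≤ C :=
      Measure.quasiMeasurePreserving_snd.ae hCt
    refine integral_congr_ae ?_
    filter_upwards [hCp] with p hp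
    by_cases hp2 : 0 < p.2
    · have e : v p.1 p.2 = u p.1 p.2 := by simp only [hv, max_eq_left hp2.le]
      simp only [truncatedEnergy, if_pos hp]
      simp only [hwx, max_eq_left hp2.le, e]
    · have hz := notMem_tsupport_iff_eventuallyEq.1 (fun h => hp2 (h3 h))
      have z1 : (fun s => φ (p.1, s)) =ᶠ[𝓝 p.2] fun _ => 0 :=
        ((by fun_prop : Continuous fun s => (p.1, s)).tendsto p.2).eventually hz
      have z2 : (fun y => φ (y, p.2)) =ᶠ[𝓝 p.1] fun _ => 0 :=
        ((by fun_prop : Continuous fun y => (y, p.2)).tendsto p.1).eventually hz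
      have z3 : φ p = 0 := hz.eq_of_nhds
      rw [z1.deriv_eq, z2.deriv_eq, z3]
      simp

namespace IsEnergySolution

variable {v f : ℝ → ℝ → ℝ} {C : ℝ}

/-- The bound holds for almost every time, hence on a dense set, and continuity in time extends it
to every time. -/
theorem sq_sub_le_mul (hv : IsEnergySolution v f C) (t : ℝ) {a b : ℝ} (hab : a ≤ b) :
    (v b t - v a t) ^ 2 ≤ (b - a) * C := by
  have hc : ∀ x, Continuous fun t => v x t := fun x =>
    hv.continuous.comp (by fun_prop : Continuous fun t => (x, t))
  have hclosed : IsClosed {t | (v b t - v a t) ^ 2 ≤ (b - a) * C} :=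
    isClosed_le (((hc b).sub (hc a)).pow 2) continuous_const
  have hdense : Dense {t | (v b t - v a t) ^ 2 ≤ (b - a) * C} := by
    refine Measure.dense_of_ae (μ := volume) ?_
    filter_upwards [hv.sq_sub_le] with t ht
    refine (ht a b hab).trans (mul_le_mul_of_nonneg_left ?_ (sub_nonneg.2 hab))
    linarith [hv.le b t, hv.nonneg a t]
  have := hclosed.closure_eq ▸ hdense t
  exact this

theorem exists_linear_growth (hv : IsEnergySolution v f C) (T : ℝ) :
    ∃ K, 0 ≤ K ∧ ∀ s ∈ Icc 0 T, ∀ x, |v x s| ≤ K * (1 + |x|) := by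
  have hC : 0 ≤ C := (hv.nonneg 0 0).trans (hv.le 0 0)
  obtain ⟨A, hA⟩ := (isCompact_Icc (a := (0 : ℝ)) (b := T)).exists_bound_of_continuousOn
    (hv.continuous.comp (by fun_prop : Continuous fun t : ℝ => ((0 : ℝ), t))).continuousOn
  refine ⟨|A| + 1 + C, by positivity, fun s hs x => ?_⟩
  have h1 : |v 0 s| ≤ |A| := (hA s hs).trans (le_abs_self A)
  have h2 : |v x s - v 0 s| ^ 2 ≤ |x| * C := by
    rw [sq_abs]
    rcases le_total 0 x with h | h
    · have := hv.sq_sub_le_mul s h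
      rw [abs_of_nonneg h]; linarith
    · have := hv.sq_sub_le_mul s h
      rw [abs_of_nonpos h]
      linarith [sub_sq_comm (v x s) (v 0 s)]
  have h3 : |v x s - v 0 s| ≤ 1 + |x| * C := by
    nlinarith [abs_nonneg (v x s - v 0 s), sq_nonneg (|v x s - v 0 s| - 1)]
  have h4 : |v x s| ≤ |v x s - v 0 s| + |v 0 s| := by
    have := abs_add_le (v x s - v 0 s) (v 0 s)
    rwa [sub_add_cancel] at this
  have h5 : 0 ≤ |x| * |A| := by positivity
  nlinarith [abs_nonneg x]

end IsEnergySolution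

/-! ### Characteristics as integral curves, and the maximal endpoint. -/

section Characteristics

variable {u : ℝ → ℝ → ℝ} {T ζ : ℝ}

theorem IsCharacteristic.exists_isCurve {x : ℝ → ℝ} (hT : 0 ≤ T)
    (hx : IsCharacteristic u T ζ x) :
    ∃ X, IsCurve (fun y t => u y (max t 0)) T X ∧ EqOn x X (Icc 0 T) ∧ X 0 = ζ := by
  obtain ⟨⟨K, hK⟩, hd, h0⟩ := hx
  set cT : ℝ → ℝ := fun s => max 0 (min T s)
  have hcT : ∀ s, cT s ∈ Icc 0 T := fun s => ⟨le_max_left _ _, max_le hT (min_le_left _ _)⟩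
  have hcT' : ∀ s ∈ Icc 0 T, cT s = s := fun s hs => by
    simp only [cT, min_eq_right hs.2, max_eq_right hs.1]
  have heq : EqOn x (fun s => x (cT s)) (Icc 0 T) := fun s hs => by simp only [hcT' s hs]
  refine ⟨fun s => x (cT s), ⟨hK.continuousOn.comp_continuous (by fun_prop) hcT, ?_⟩, heq, ?_⟩
  · intro a ha b hb
    have hsub : uIcc a b ⊆ Icc 0 T := (convex_Icc (0 : ℝ) T).ordConnected.uIcc_subset ha hb
    have hac : AbsolutelyContinuousOnInterval x a b := (hK.mono hsub).absolutelyContinuousOnInterval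
    simp only [hcT' a ha, hcT' b hb]
    rw [← hac.integral_deriv_eq_sub]
    rw [ae_restrict_iff' measurableSet_Icc] at hd
    refine intervalIntegral.integral_congr_ae ?_
    filter_upwards [hd] with s hs hsab
    have hs' := hsub (uIoc_subset_uIcc hsab)
    simp only [hcT' s hs', max_eq_left hs'.1]
    exact (hs hs').deriv
  · simp only [hcT' 0 ⟨le_rfl, hT⟩, h0]

theorem IsCurve.isCharacteristic {X : ℝ → ℝ}
    (hv : Continuous fun p : ℝ × ℝ => u p.1 (max p.2 0))
    (hX : IsCurve (fun y t => u y (max t 0)) T X) : IsCharacteristic u T (X 0) X := by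
  have hd := fun s (hs : s ∈ Icc 0 T) => hX.hasDerivWithinAt hv hs
  have hc : Continuous fun s => u (X s) (max s 0) :=
    hv.comp (hX.continuous.prodMk continuous_id)
  obtain ⟨M, hM⟩ := (isCompact_Icc (a := (0 : ℝ)) (b := T)).exists_bound_of_continuousOn
    hc.continuousOn
  refine ⟨⟨M.toNNReal, ?_⟩, ?_, rfl⟩
  · refine (convex_Icc 0 T).lipschitzOnWith_of_nnnorm_hasDerivWithin_le hd fun s hs => ?_
    rw [← NNReal.coe_le_coe]
    exact (hM s hs).trans (Real.le_coe_toNNReal M)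
  · have h0 : ∀ᵐ s : ℝ, s ≠ 0 := by simp [ae_iff]
    have h1 : ∀ᵐ s : ℝ, s ≠ T := by simp [ae_iff]
    filter_upwards [ae_restrict_mem measurableSet_Icc, ae_restrict_of_ae h0, ae_restrict_of_ae h1]
      with s hs hs0 hsT
    have := (hd s hs).hasDerivAt
      (Icc_mem_nhds (lt_of_le_of_ne hs.1 hs0.symm) (lt_of_le_of_ne hs.2 hsT))
    simpa only [max_eq_left hs.1] using this

/-- Following a curve up to a point where it meets another one, and the latter from there on. -/
theorem IsCurve.glue {v : ℝ → ℝ → ℝ} {X Y : ℝ → ℝ}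
    (hv : Continuous fun p : ℝ × ℝ => v p.1 p.2) (hX : IsCurve v T X) (hY : IsCurve v T Y) {c : ℝ}
    (hc : c ∈ Icc 0 T) (hXY : X c = Y c) :
    IsCurve v T (fun s => if s ≤ c then X s else Y s) := by
  set Z : ℝ → ℝ := fun s => if s ≤ c then X s else Y s with hZ
  have hZc : Continuous Z := Continuous.if_le hX.continuous hY.continuous continuous_id
    continuous_const (fun s hs => by rw [hs, hXY])
  have hZX : ∀ s ≤ c, Z s = X s := fun s hs => if_pos hs
  have hZY : ∀ s, c ≤ s → Z s = Y s := fun s hs => by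
    rcases hs.eq_or_lt with rfl | h
    · rw [hZX _ le_rfl, hXY]
    · exact if_neg (not_le.2 h)
  have hi : ∀ a b, IntervalIntegrable (fun s => v (Z s) s) volume a b := fun a b =>
    (hv.comp (hZc.prodMk continuous_id)).intervalIntegrable a b
  have key : ∀ b ∈ Icc 0 T, Z b - Z c = ∫ s in c..b, v (Z s) s := by
    intro b hb
    rcases le_total b c with h | h
    · rw [hZX b h, hZX c le_rfl, hX.integral_eq c hc b hb]
      refine intervalIntegral.integral_congr fun s hs => ?_
      rw [uIcc_of_ge h] at hs
      simp only [hZX s hs.2]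
    · rw [hZY b h, hZY c le_rfl, hY.integral_eq c hc b hb]
      refine intervalIntegral.integral_congr fun s hs => ?_
      rw [uIcc_of_le h] at hs
      simp only [hZY s hs.1]
  refine ⟨hZc, fun a ha b hb => ?_⟩
  rw [← intervalIntegral.integral_add_adjacent_intervals (hi a c) (hi c b),
    intervalIntegral.integral_symm, ← key a ha, ← key b hb]
  ring

/-- The largest value at time `T` among the curves that start at `η`. -/
noncomputable def maxEndpoint (v : ℝ → ℝ → ℝ) (T η : ℝ) : ℝ :=
  sSup {y | ∃ X, IsCurve v T X ∧ X 0 = η ∧ X T = y}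

section Endpoint

variable {v f : ℝ → ℝ → ℝ} {C : ℝ}

theorem IsEnergySolution.bddAbove_endpoints (hv : IsEnergySolution v f C) (hT : 0 ≤ T) (η : ℝ) :
    BddAbove {y | ∃ X, IsCurve v T X ∧ X 0 = η ∧ X T = y} := by
  obtain ⟨K, hK0, hK⟩ := hv.exists_linear_growth T
  refine ⟨gronwallBound |η| K K T, ?_⟩
  rintro y ⟨X, hX, rfl, rfl⟩
  exact (le_abs_self _).trans (hX.abs_le hv.continuous hK0 hK ⟨hT, le_rfl⟩)

theorem IsEnergySolution.exists_isCurve (hv : IsEnergySolution v f C) (hT : 0 ≤ T) (η : ℝ) :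
    ∃ X, IsCurve v T X ∧ X 0 = η := by
  obtain ⟨K, hK0, hK⟩ := hv.exists_linear_growth T
  exact HunterSaxton.exists_isCurve hv.continuous hT hK0 hK η

theorem IsEnergySolution.le_maxEndpoint (hv : IsEnergySolution v f C) (hT : 0 ≤ T) {X : ℝ → ℝ}
    (hX : IsCurve v T X) : X T ≤ maxEndpoint v T (X 0) :=
  le_csSup (hv.bddAbove_endpoints hT _) ⟨X, hX, rfl, rfl⟩

theorem IsEnergySolution.monotone_maxEndpoint (hv : IsEnergySolution v f C) (hT : 0 ≤ T) :
    Monotone (maxEndpoint v T) := by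
  intro η₁ η₂ hη
  obtain ⟨X₀, hX₀, hX₀'⟩ := hv.exists_isCurve hT η₁
  refine csSup_le ⟨_, X₀, hX₀, hX₀', rfl⟩ ?_
  rintro y ⟨X, hX, hX0, rfl⟩
  obtain ⟨Y, hY, rfl⟩ := hv.exists_isCurve hT η₂
  have hYT := hv.le_maxEndpoint hT hY
  rcases le_total (X T) (Y T) with h | h
  · exact h.trans hYT
  -- A curve from `η₁` that overtakes `Y` must meet it. Following `Y` up to the meeting point and
  -- `X` afterwards gives a competitor from `η₂` with endpoint `X T`.
  · obtain ⟨c, hc, hc'⟩ := intermediate_value_Icc hT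
      (hX.continuous.sub hY.continuous).continuousOn
      (show (0 : ℝ) ∈ Icc (X 0 - Y 0) (X T - Y T) by constructor <;> linarith)
    have hcXY : Y c = X c := (sub_eq_zero.1 hc').symm
    have hZ := hv.le_maxEndpoint hT (hY.glue hv.continuous hX hc hcXY)
    simp only [hc.1, if_true] at hZ
    refine le_trans (le_of_eq ?_) hZ
    split_ifs with h'
    · rw [le_antisymm hc.2 h'] at hcXY; exact hcXY.symm
    · rfl

end Endpoint

end Characteristics

/-! ### Estimates for pairs of characteristics and the conclusion. -/

/-- Two curves whose difference quotient at time `0` exceeds `-2 / t`, and whose distance grows up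
to time `t` by a factor at most `L`, do not come together before time `τ < t`, and their difference
quotient is bounded up to time `τ`. -/
theorem IsEnergySolution.curve_estimates {v f : ℝ → ℝ → ℝ} {C t τ L : ℝ}
    (hv : IsEnergySolution v f C) (hτ : 0 < τ) (hτt : τ < t) {X₁ X₂ : ℝ → ℝ}
    (h₁ : IsCurve v t X₁) (h₂ : IsCurve v t X₂) (h0 : X₁ 0 < X₂ 0)
    (hω : -2 / t < (v (X₂ 0) 0 - v (X₁ 0) 0) / (X₂ 0 - X₁ 0))
    (hL : X₂ t - X₁ t ≤ L * (X₂ 0 - X₁ 0)) {s : ℝ} (hs : s ∈ Icc 0 τ) :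
    (1 - τ / t) ^ 2 * (X₂ 0 - X₁ 0) ≤ X₂ s - X₁ s ∧
      v (X₂ s) s - v (X₁ s) s ≤ 2 * √L / ((1 - τ / t) * (t - τ)) * (X₂ s - X₁ s) := by
  have ht : 0 < t := hτ.trans hτt
  set h : ℝ → ℝ := fun s => X₂ s - X₁ s with hh
  set p : ℝ → ℝ := fun s => v (X₂ s) s - v (X₁ s) s with hp
  have hhc : Continuous h := h₂.continuous.sub h₁.continuous
  have hpc : Continuous p := (hv.continuous.comp (h₂.continuous.prodMk continuous_id)).sub
    (hv.continuous.comp (h₁.continuous.prodMk continuous_id))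
  have hder : ∀ x ∈ Ico 0 t, HasDerivWithinAt h (p x) (Ici x) x := fun x hx =>
    (h₂.hasDerivWithinAt_Ici hv.continuous hx).sub (h₁.hasDerivWithinAt_Ici hv.continuous hx)
  have hh0 : 0 < h 0 := sub_pos.2 h0
  have hω0 : -2 / t < p 0 / h 0 := hω
  have hωs : ∀ r ∈ Icc 0 t, 1 - r / t ≤ 1 + p 0 / h 0 * (r - 0) / 2 := by
    intro r hr
    have := mul_le_mul_of_nonneg_right hω0.le hr.1
    have e : -2 / t * r = -2 * (r / t) := by ring
    rw [sub_zero]; linarith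
  have hωt : 0 < 1 + p 0 / h 0 * (t - 0) / 2 := by
    have := mul_lt_mul_of_pos_right hω0 ht
    rw [div_mul_cancel₀ _ ht.ne'] at this
    rw [sub_zero]; linarith
  have hpos : ∀ x ∈ Icc 0 t, 0 < h x := pos_of_riccati hhc hpc hder hh0 hωt
    fun x hx y hy hxy hxypos => hv.riccati h₁ h₂ hx.1 hxy hy.2 hxypos
  have haff : ∀ a b, 0 ≤ a → a ≤ b → b ≤ t →
      √(h a) * (1 + p a / h a * (b - a) / 2) ≤ √(h b) := fun a b ha hab hb =>
    sqrt_ge_affine_of_riccati hab hhc hpc (fun x hx => hder x ⟨ha.trans hx.1, hx.2.trans_le hb⟩)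
      (fun x hx => hpos x ⟨ha.trans hx.1, hx.2.trans hb⟩)
      fun x hx y hy hxy => hv.riccati h₁ h₂ (ha.trans hx.1) hxy (hy.2.trans hb)
        fun r hr => hpos r ⟨ha.trans (hx.1.trans hr.1), hr.2.trans (hy.2.trans hb)⟩
  have hst : s ≤ t := hs.2.trans hτt.le
  set c := 1 - τ / t with hc
  have hcpos : 0 < c := sub_pos.2 ((div_lt_one ht).2 hτt)
  have hsq0 := Real.sqrt_pos.2 hh0
  have hsqs : c * √(h 0) ≤ √(h s) := by
    refine le_trans ?_ (haff 0 s le_rfl hs.1 hst)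
    rw [mul_comm]
    refine mul_le_mul_of_nonneg_left (le_trans ?_ (hωs s ⟨hs.1, hst⟩)) hsq0.le
    have : s / t ≤ τ / t := by gcongr; exact hs.2
    linarith
  have hhs := hpos s ⟨hs.1, hst⟩
  refine ⟨?_, ?_⟩
  · calc c ^ 2 * h 0 = (c * √(h 0)) ^ 2 := by rw [mul_pow, Real.sq_sqrt hh0.le]
      _ ≤ √(h s) ^ 2 := by gcongr
      _ = h s := Real.sq_sqrt hhs.le
  · have htτ : 0 < t - τ := sub_pos.2 hτt
    rw [← div_le_iff₀ hhs, le_div_iff₀ (by positivity)]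
    change p s / h s * (c * (t - τ)) ≤ 2 * √L
    rcases le_total (p s / h s) 0 with hneg | hnn
    · have := mul_nonpos_of_nonpos_of_nonneg hneg (by positivity : 0 ≤ c * (t - τ))
      linarith [Real.sqrt_nonneg L]
    · have k1 := haff s t hs.1 hst le_rfl
      have k2 : √(h t) ≤ √L * √(h 0) := by
        rw [← Real.sqrt_mul' _ hh0.le]
        exact Real.sqrt_le_sqrt hL
      have k3 : p s / h s * (t - τ) ≤ p s / h s * (t - s) :=
        mul_le_mul_of_nonneg_left (by linarith [hs.2]) hnn
      have k4 : c * √(h 0) * (1 + p s / h s * (t - τ) / 2) ≤ √L * √(h 0) := by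
        have : 0 ≤ p s / h s * (t - τ) := mul_nonneg hnn htτ.le
        calc _ ≤ √(h s) * (1 + p s / h s * (t - s) / 2) := by gcongr
          _ ≤ _ := k1.trans k2
      -- The factor `√(h 0)` cancels, so the bound does not depend on the initial distance; dropping
      -- the positive term `c` on the left gives the constant claimed.
      have k5 : c * (1 + p s / h s * (t - τ) / 2) ≤ √L := by
        refine le_of_mul_le_mul_right ?_ hsq0
        linarith
      linarith

end HunterSaxton

open Filter Topology HunterSaxton in
theorem mainTheorem8 (u : ℝ → ℝ → ℝ) (u₀ w₀ : ℝ → ℝ)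
    (hu : HunterSaxton.IsWeakSolution u u₀ w₀) (t τ : ℝ) (hτ : 0 < τ) (hτt : τ < t) :
    ∀ᵐ ζ : ℝ, ζ ∈ HunterSaxton.setJtUnique u u₀ w₀ t →
      ∃ M : ℝ, 0 < M ∧ ∃ ε : ℝ, 0 < ε ∧
        ∀ xζ : ℝ → ℝ, HunterSaxton.IsCharacteristic u t ζ xζ →
          ∀ η ∈ Set.Ioc ζ (ζ + ε), ∀ s ∈ Set.Icc 0 τ,
            HunterSaxton.omega u xζ (HunterSaxton.leftmostChar u t η) s ≤ M := by
  obtain ⟨f, C, hv⟩ := hu.exists_isEnergySolution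
  set v : ℝ → ℝ → ℝ := fun x t => u x (max t 0) with hvdef
  have ht : 0 < t := hτ.trans hτt
  have hvu : ∀ y s, 0 ≤ s → v y s = u y s := fun y s hs => by simp only [hvdef, max_eq_left hs]
  have hvu₀ : ∀ y, v y 0 = u₀ y := fun y => by rw [hvu y 0 le_rfl, hu.initial]
  filter_upwards [(hv.monotone_maxEndpoint ht.le).ae_differentiableAt] with ζ hF hζ
  obtain ⟨⟨⟨hI, hw⟩, huniq⟩, -⟩ := hζ
  -- Only a local Lipschitz bound at `ζ` is needed from the derivative of the maximal endpoint.
  obtain ⟨L, hL, hFL⟩ := hF.isBigO_sub.exists_pos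
  have hslope := (hasDerivWithinAt_iff_tendsto_slope.1
    (HasDerivAt.hasDerivWithinAt (s := Ioi ζ) hI)).eventually (lt_mem_nhds hw)
  rw [sdiff_singleton_eq_self self_notMem_Ioi] at hslope
  obtain ⟨b, hb, hbsub⟩ := mem_nhdsGT_iff_exists_Ioc_subset.1
    (hslope.and (hFL.bound.filter_mono nhdsWithin_le_nhds))
  have hc : 0 < 1 - τ / t := sub_pos.2 ((div_lt_one ht).2 hτt)
  have htτ : 0 < t - τ := sub_pos.2 hτt
  refine ⟨2 * √L / ((1 - τ / t) * (t - τ)), by positivity, b - ζ, sub_pos.2 hb, ?_⟩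
  intro xζ hxζ η hη s hs
  rw [add_sub_cancel] at hη
  obtain ⟨hslη, hFη⟩ := hbsub hη
  obtain ⟨X₁, hX₁, hxX₁, hX₁0⟩ := hxζ.exists_isCurve ht.le
  have hst : s ∈ Icc 0 t := ⟨hs.1, hs.2.trans hτt.le⟩
  -- Here uniqueness enters: every curve from `ζ` ends where `X₁` does.
  have hFζ : maxEndpoint v t ζ ≤ X₁ t := by
    refine csSup_le ⟨_, X₁, hX₁, hX₁0, rfl⟩ ?_
    rintro y ⟨X, hX, hX0, rfl⟩
    have hXc := hX.isCharacteristic hv.continuous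
    rw [hX0] at hXc
    rw [huniq X xζ hXc hxζ ⟨ht.le, le_rfl⟩, hxX₁ ⟨ht.le, le_rfl⟩]
  have hηζ : 0 < η - ζ := sub_pos.2 hη.1
  set S : Set ℝ := {y | ∃ x, IsCharacteristic u t η x ∧ x s = y} with hS
  -- The slope bound is written without division so that the set is closed. The lower bound on `y`
  -- keeps the infimum strictly to the right of `xζ s`, which permits dividing at the end.
  set G : Set ℝ := {y | xζ s + (1 - τ / t) ^ 2 * (η - ζ) ≤ y ∧
    v y s - v (xζ s) s ≤ 2 * √L / ((1 - τ / t) * (t - τ)) * (y - xζ s)} with hG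
  have hSG : S ⊆ G := by
    rintro y ⟨x, hx, rfl⟩
    obtain ⟨X₂, hX₂, hxX₂, hX₂0⟩ := hx.exists_isCurve ht.le
    have hle : X₂ t - X₁ t ≤ L * (X₂ 0 - X₁ 0) := by
      have h1 := hv.le_maxEndpoint ht.le hX₂
      rw [hX₂0] at h1
      rw [hX₂0, hX₁0]
      rw [Real.norm_eq_abs, Real.norm_eq_abs, abs_of_pos hηζ] at hFη
      linarith [le_abs_self (maxEndpoint v t η - maxEndpoint v t ζ)]
    have hest := hv.curve_estimates hτ hτt hX₁ hX₂ (by rw [hX₁0, hX₂0]; exact hη.1)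
      (by rw [hX₁0, hX₂0, hvu₀, hvu₀, ← slope_def_field]; exact hslη) hle hs
    rw [← hxX₁ hst, ← hxX₂ hst, hX₁0, hX₂0] at hest
    exact ⟨by linarith [hest.1], hest.2⟩
  have hSne : S.Nonempty := by
    obtain ⟨X, hX, hX0⟩ := hv.exists_isCurve ht.le η
    exact ⟨X s, X, hX0 ▸ hX.isCharacteristic hv.continuous, rfl⟩
  have hSbdd : BddBelow S := ⟨_, fun y hy => (hSG hy).1⟩
  have hvs : Continuous fun y => v y s :=
    hv.continuous.comp (by fun_prop : Continuous fun y => (y, s))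
  have hGc : IsClosed G := (isClosed_le continuous_const continuous_id).inter
    (isClosed_le (hvs.sub continuous_const) (by fun_prop))
  have hm : leftmostChar u t η s ∈ G :=
    closure_minimal hSG hGc (csInf_mem_closure hSne hSbdd)
  have hpos : 0 < leftmostChar u t η s - xζ s := by
    have : 0 < (1 - τ / t) ^ 2 * (η - ζ) := by positivity
    linarith [hm.1]
  rw [omega, div_le_iff₀ hpos, ← hvu _ s hs.1, ← hvu _ s hs.1]
  exact hm.2
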